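/- **Theorem (Exponential clustering).** *Setting.* Let $\Lambda=[a,b]\subset\mathbb Z$ be a finite interval and let $c_x,c_x^*$ $(x\in\Lambda)$ be the fermionic annihilation and creation operators on the fermionic Fock space $\mathcal F_\Lambda$ over $\ell^2(\Lambda)$, with vacuum $|\emptyset\rangle$. For $X\subseteq\Lambda$ let $\mathcal A_X$ be the algebra generated by $\{c_x,c_x^*:x\in X\}$, and let $\mathcal A_X^e$ (even observables) and $\mathcal A_X^o$ (odd observables) be the spans of the monomials of even, respectively odd, degree in these operators. *Tilings.* A root tiling $R$ of $\Lambda$ is a tiling of $\Lambda$ by consecutive dominoes, each of which is a void (length 1) or a monomer (length 3), except that the first domino may be a left boundary dimer (length 5) and the last one may be a right boundary dimer (length 3), a right 1-monomer (length 1) or a right 2-monomer (length 2). $\mathcal D_\Lambda(R)$ is the set of all tilings obtained from $R$ by any number of substitutions in which two adjacent monomers are replaced by a dimer (length 6), or a monomer followed by a right 1-monomer or 2-monomer is replaced by a truncated dimer (length 4, respectively 5). Fix $\lambda\in\mathbb C\setminus\{0\}$. To a domino $D$ that starts at $x$ one associates $C_D^*=1$ if $D$ is a void, $C_D^*=c_x^*$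 if $D$ is a monomer or a right 1- or 2-monomer, $C_D^*=\lambda c_{x+1}^*c_{x+2}^*$ if $D$ is a dimer, a truncated dimer or a right boundary dimer, and $C_D^*=\lambda c_x^*c_{x+1}^*$ if $D$ is the left boundary dimer. The tiling (void-monomer-dimer, VMD) state $\omega_R^\Lambda$ is the vector state $\omega_R^\Lambda(A)=\langle\psi_\Lambda(R),A\,\psi_\Lambda(R)\rangle/\|\psi_\Lambda(R)\|^2$ of $$\psi_\Lambda(R)=\sum_{(D_1,\dots,D_N)\in\mathcal D_\Lambda(R)}C_{D_1}^*\cdots C_{D_N}^*|\emptyset\rangle ,$$ where the dominoes are listed from left to right. *Claim.* Set $$c(\lambda)=\frac13\ln\frac{\sqrt{4|\lambda|^2+1}+1}{\sqrt{4|\lambda|^2+1}-1}.$$ For every $\lambda\in\mathbb C\setminus\{0\}$, every finite interval $\Lambda$, every root tiling $R$ of $\Lambda$ and all nonempty subintervals $X,Y\subseteq\Lambda$ with $\operatorname{dist}(X,Y)=\min_{x\in X,y\in Y}|x-y|\ge 20$: 1. For all even observables $A_1\in\mathcal A_X^e$ and $A_2\in\mathcal A_Y^e$, $$\left|\omega_R^\Lambda(A_1A_2)-\omega_R^\Lambda(A_1)\,\omega_R^\Lambda(A_2)\right|\le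 8\,\|A_1\|\,\|A_2\|\,e^{-c(\lambda)(\operatorname{dist}(X,Y)-20)/2}.$$ 2. For every odd observable $A_1\in\mathcal A_X^o$ and every observable $A_2\in\mathcal A_Y$, $\omega_R^\Lambda(A_1A_2)=\omega_R^\Lambda(A_1)=0$. 3. (Spin form.) Let $\omega_R^{\Lambda,\mathrm s}$ be the vector state on $\mathcal B\big(\bigotimes_{x\in\Lambda}\mathbb C^2\big)$ of the normalized vector obtained from the same formula for $\psi_\Lambda(R)$ with $c_x^*$ replaced by the spin raising operator $\sigma_x^+$ and $|\emptyset\rangle$ by the product vector of all spins down. Then the bound of part 1 holds for $\omega_R^{\Lambda,\mathrm s}$ and all $A_1\in\mathcal B\big(\bigotimes_{x\in X}\mathbb C^2\big)$, $A_2\in\mathcal B\big(\bigotimes_{x\in Y}\mathbb C^2\big)$, identified with operators on $\bigotimes_{x\in\Lambda}\mathbb C^2$ by tensoring with the identity. The bounds are uniform in $\Lambda$ and $R$: their right-hand sides depend on neither. -/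

import Mathlib

open Finset

namespace VMD

noncomputable section

/-! ### The Hilbert space and the one-site operators -/

/-- Configurations `σ ∈ {0,1}^Λ`: `σ x = true` means that the site `x` is occupied (spin up). -/
abbrev Config (Λ : Finset ℤ) : Type := ↥Λ → Bool

/-- The Hilbert space with orthonormal basis `|σ⟩`, `σ ∈ {0,1}^Λ`. It is the fermionic Fock space
over `ℓ²(Λ)` in its occupation number basis
`|σ⟩ = c*_{x₁} ⋯ c*_{x_N} |∅⟩`, with `x₁ < ⋯ < x_N` the occupied sites of `σ`,
and it is also the spin space `⨂_{x ∈ Λ} ℂ²` in its tensor product basis. -/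
abbrev Space (Λ : Finset ℤ) : Type := EuclideanSpace ℂ (Config Λ)

/-- Operators on the Hilbert space, with the operator norm. -/
abbrev Op (Λ : Finset ℤ) : Type := Space Λ →L[ℂ] Space Λ

/-- The operator with matrix elements `⟨σ| A |τ⟩ = M σ τ`. -/
def opOfMatrix (Λ : Finset ℤ) (M : Config Λ → Config Λ → ℂ) : Op Λ :=
  Matrix.toEuclideanCLM (n := Config Λ) (𝕜 := ℂ) (Matrix.of M)

/-- The vector `|0⟩` of the empty configuration: the Fock vacuum, or all spins down. -/
def vacuum (Λ : Finset ℤ) : Space Λ := EuclideanSpace.single (fun _ => false) 1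

/-- The fermionic annihilation operator `c_x`: if `x` is occupied in `τ`, then
`c_x |τ⟩ = (-1)^{#{y < x occupied in τ}} |τ with x emptied⟩`, and otherwise `c_x |τ⟩ = 0`.
Only sites `x ∈ Λ` matter; the value outside `Λ` is `0`. -/
def annihilation (Λ : Finset ℤ) (x : ℤ) : Op Λ :=
  if hx : x ∈ Λ then
    opOfMatrix Λ fun σ τ =>
      if τ ⟨x, hx⟩ = true ∧ σ = Function.update τ ⟨x, hx⟩ false then
        (-1 : ℂ) ^ #{y : ↥Λ | (y : ℤ) < x ∧ τ y = true}
      else 0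
  else 0

/-- The fermionic creation operator `c_x^*`. -/
def creation (Λ : Finset ℤ) (x : ℤ) : Op Λ := ContinuousLinearMap.adjoint (annihilation Λ x)

/-- The spin raising operator `σ_x^+`: `σ_x^+ |τ⟩ = |τ with x up⟩` if `x` is down in `τ`, and
`σ_x^+ |τ⟩ = 0` otherwise. Only sites `x ∈ Λ` matter; the value outside `Λ` is `0`. -/
def spinRaise (Λ : Finset ℤ) (x : ℤ) : Op Λ :=
  if hx : x ∈ Λ then
    opOfMatrix Λ fun σ τ =>
      if τ ⟨x, hx⟩ = false ∧ σ = Function.update τ ⟨x, hx⟩ true then 1 else 0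
  else 0

/-! ### Local observables -/

/-- The generators `c_x, c_x^*`, `x ∈ X`, of the fermionic observables on `X`. -/
def fermionGenerators (Λ X : Finset ℤ) : Set (Op Λ) :=
  {A | ∃ x ∈ X, A = annihilation Λ x ∨ A = creation Λ x}

/-- The algebra `𝒜_X` of fermionic observables supported on `X ⊆ Λ`. -/
def fermionAlgebra (Λ X : Finset ℤ) : Subalgebra ℂ (Op Λ) :=
  Algebra.adjoin ℂ (fermionGenerators Λ X)

/-- The even observables `𝒜_X^e`: the span of the monomials of even degree in `c_x, c_x^*`. -/
def evenObservables (Λ X : Finset ℤ) : Submodule ℂ (Op Λ) :=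
  Submodule.span ℂ
    {A | ∃ l : List (Op Λ), (∀ c ∈ l, c ∈ fermionGenerators Λ X) ∧ Even l.length ∧ A = l.prod}

/-- The odd observables `𝒜_X^o`: the span of the monomials of odd degree in `c_x, c_x^*`. -/
def oddObservables (Λ X : Finset ℤ) : Submodule ℂ (Op Λ) :=
  Submodule.span ℂ
    {A | ∃ l : List (Op Λ), (∀ c ∈ l, c ∈ fermionGenerators Λ X) ∧ Odd l.length ∧ A = l.prod}

/-- The restriction of a configuration on `Λ` to `X ⊆ Λ`. -/
def restrictConfig {X Λ : Finset ℤ} (h : X ⊆ Λ) (σ : Config Λ) : Config X :=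
  fun x => σ ⟨x, h x.2⟩

/-- The spin observable `A ⊗ 1_{Λ ∖ X}` on `Λ` of an operator `A` on the spin space of `X ⊆ Λ`:
`⟨σ| A ⊗ 1 |τ⟩ = ⟨σ|_X | A |τ|_X⟩` if `σ = τ` off `X`, and `0` otherwise. -/
def spinEmbed {X Λ : Finset ℤ} (h : X ⊆ Λ) (A : Op X) : Op Λ :=
  opOfMatrix Λ fun σ τ =>
    if ∀ y : ↥Λ, (y : ℤ) ∉ X → σ y = τ y then
      inner ℂ (EuclideanSpace.single (restrictConfig h σ) (1 : ℂ))
        (A (EuclideanSpace.single (restrictConfig h τ) 1))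
    else 0

/-! ### Tilings -/

/-- The dominoes: the basic void, monomer and dimer, the left boundary dimer `B_d^l`, and the right
boundary dominoes `B_d^r`, `B_{1m}^r`, `B_{2m}^r`, `B_{1d}^r`, `B_{2d}^r`. -/
inductive Domino : Type
  | void
  | monomer
  | dimer
  | leftDimer
  | rightDimer
  | rightMonomer1
  | rightMonomer2
  | truncatedDimer1
  | truncatedDimer2
  deriving DecidableEq

/-- The number of sites that a domino covers. -/
def Domino.length : Domino → ℕ
  | .void => 1
  | .monomer => 3
  | .dimer => 6
  | .leftDimer => 5
  | .rightDimer => 3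
  | .rightMonomer1 => 1
  | .rightMonomer2 => 2
  | .truncatedDimer1 => 4
  | .truncatedDimer2 => 5

/-- `R` is the ordered list of dominoes of a root tiling of the interval `[a, b]`: voids and
monomers, possibly preceded by a left boundary dimer, and possibly followed by a right boundary
dimer, a right 1-monomer or a right 2-monomer, of total length `|[a, b]|`. -/
def IsRootTiling (a b : ℤ) (R : List Domino) : Prop :=
  ∃ l m r : List Domino, R = l ++ m ++ r ∧
    (l = [] ∨ l = [.leftDimer]) ∧
    (∀ D ∈ m, D = .void ∨ D = .monomer) ∧
    (r = [] ∨ r = [.rightDimer] ∨ r = [.rightMonomer1] ∨ r = [.rightMonomer2]) ∧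
    (R.map Domino.length).sum = #(Icc a b)

/-- One application of a substitution rule: two adjacent monomers become a dimer, and a monomer
followed by a right 1- or 2-monomer becomes the corresponding truncated dimer. -/
inductive Substitution : List Domino → List Domino → Prop
  | dimer (s t : List Domino) :
      Substitution (s ++ .monomer :: .monomer :: t) (s ++ .dimer :: t)
  | truncatedDimer1 (s t : List Domino) :
      Substitution (s ++ .monomer :: .rightMonomer1 :: t) (s ++ .truncatedDimer1 :: t)
  | truncatedDimer2 (s t : List Domino) :
      Substitution (s ++ .monomer :: .rightMonomer2 :: t) (s ++ .truncatedDimer2 :: t)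

/-- The set `𝒟_Λ(R)` of the tilings obtained from `R` by any number of substitutions
(see `mem_vmdTilings_iff`). -/
def vmdTilings : List Domino → Finset (List Domino)
  | [] => {[]}
  | .monomer :: .monomer :: t =>
      (vmdTilings (.monomer :: t)).image (List.cons .monomer) ∪
        (vmdTilings t).image (List.cons .dimer)
  | .monomer :: .rightMonomer1 :: t =>
      (vmdTilings (.rightMonomer1 :: t)).image (List.cons .monomer) ∪
        (vmdTilings t).image (List.cons .truncatedDimer1)
  | .monomer :: .rightMonomer2 :: t =>
      (vmdTilings (.rightMonomer2 :: t)).image (List.cons .monomer) ∪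
        (vmdTilings t).image (List.cons .truncatedDimer2)
  | D :: t => (vmdTilings t).image (List.cons D)

theorem Substitution.cons (D : Domino) {S T : List Domino} (h : Substitution S T) :
    Substitution (D :: S) (D :: T) := by
  cases h with
  | dimer s t => exact Substitution.dimer (D :: s) t
  | truncatedDimer1 s t => exact Substitution.truncatedDimer1 (D :: s) t
  | truncatedDimer2 s t => exact Substitution.truncatedDimer2 (D :: s) t

theorem Substitution.cons_inv {D : Domino} {S T : List Domino} (h : Substitution (D :: S) T) :
    (∃ T', T = D :: T' ∧ Substitution S T') ∨
    (∃ t, D = .monomer ∧ S = .monomer :: t ∧ T = .dimer :: t) ∨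
    (∃ t, D = .monomer ∧ S = .rightMonomer1 :: t ∧ T = .truncatedDimer1 :: t) ∨
    (∃ t, D = .monomer ∧ S = .rightMonomer2 :: t ∧ T = .truncatedDimer2 :: t) := by
  generalize hL : D :: S = L at h
  cases h with
  | dimer s t =>
    rcases s with _ | ⟨E, s⟩
    · simp_all
    · simp only [List.cons_append, List.cons.injEq] at hL
      obtain ⟨rfl, rfl⟩ := hL
      exact Or.inl ⟨_, rfl, Substitution.dimer s t⟩
  | truncatedDimer1 s t =>
    rcases s with _ | ⟨E, s⟩
    · simp_all
    · simp only [List.cons_append, List.cons.injEq] at hL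
      obtain ⟨rfl, rfl⟩ := hL
      exact Or.inl ⟨_, rfl, Substitution.truncatedDimer1 s t⟩
  | truncatedDimer2 s t =>
    rcases s with _ | ⟨E, s⟩
    · simp_all
    · simp only [List.cons_append, List.cons.injEq] at hL
      obtain ⟨rfl, rfl⟩ := hL
      exact Or.inl ⟨_, rfl, Substitution.truncatedDimer2 s t⟩

theorem reflTransGen_cons (D : Domino) {S T : List Domino}
    (h : Relation.ReflTransGen Substitution S T) :
    Relation.ReflTransGen Substitution (D :: S) (D :: T) := by
  induction h with
  | refl => exact .refl
  | tail _ h ih => exact ih.tail (h.cons D)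

theorem self_mem_vmdTilings (R : List Domino) : R ∈ vmdTilings R := by
  fun_induction vmdTilings R <;> simp_all

theorem cons_mem_vmdTilings {R T : List Domino} {D : Domino}
    (hD : D = .monomer ∨ D = .rightMonomer1 ∨ D = .rightMonomer2)
    (h : D :: T ∈ vmdTilings R) : ∃ S, R = D :: S ∧ T ∈ vmdTilings S := by
  rcases hD with rfl | rfl | rfl <;>
  · revert h
    fun_cases vmdTilings R <;> simp_all

theorem cons_vmdTilings {t U : List Domino} (D : Domino) (hU : U ∈ vmdTilings t) :
    D :: U ∈ vmdTilings (D :: t) := by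
  generalize hL : D :: t = L
  revert hL
  fun_cases vmdTilings L <;> rintro ⟨⟩ <;> simp_all

theorem vmdTilings_step {R T T' : List Domino} (h : T ∈ vmdTilings R) (hs : Substitution T T') :
    T' ∈ vmdTilings R := by
  have key : ∀ (D : Domino) (t S T' : List Domino), S ∈ vmdTilings t →
      (∀ {S S'}, S ∈ vmdTilings t → Substitution S S' → S' ∈ vmdTilings t) →
      Substitution (D :: S) T' → T' ∈ vmdTilings (D :: t) := by
    intro D t S T' hS ih hs
    rcases hs.cons_inv with ⟨U, rfl, hU⟩ | ⟨u, rfl, rfl, rfl⟩ | ⟨u, rfl, rfl, rfl⟩ |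
      ⟨u, rfl, rfl, rfl⟩
    · exact cons_vmdTilings D (ih hS hU)
    all_goals
      obtain ⟨v, rfl, hv⟩ := cons_mem_vmdTilings (by simp) hS
      simp [vmdTilings, hv]
  have inert : ∀ (D : Domino) (S T' : List Domino), D ≠ .monomer → Substitution (D :: S) T' →
      ∃ U, T' = D :: U ∧ Substitution S U := by
    intro D S T' hD hs
    rcases hs.cons_inv with ⟨U, rfl, hU⟩ | ⟨u, rfl, rfl, rfl⟩ | ⟨u, rfl, rfl, rfl⟩ |
      ⟨u, rfl, rfl, rfl⟩
    · exact ⟨U, rfl, hU⟩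
    all_goals exact absurd rfl hD
  induction R using vmdTilings.induct generalizing T T' with
  | case1 =>
    simp only [vmdTilings, Finset.mem_singleton] at h
    subst h
    generalize hL : ([] : List Domino) = L at hs
    cases hs <;> simp at hL
  | case2 t ih1 ih2 | case3 t ih1 ih2 | case4 t ih1 ih2 =>
    rw [vmdTilings, Finset.mem_union, Finset.mem_image, Finset.mem_image] at h
    rcases h with ⟨S, hS, rfl⟩ | ⟨S, hS, rfl⟩
    · exact key _ _ S T' hS ih1 hs
    · obtain ⟨U, rfl, hU⟩ := inert _ _ _ (by simp) hs
      have := ih2 hS hU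
      simp [vmdTilings, this]
  | case5 D t h1 h2 h3 ih =>
    rw [vmdTilings.eq_5 D t h1 h2 h3, Finset.mem_image] at h
    obtain ⟨S, hS, rfl⟩ := h
    exact key _ _ S T' hS ih hs

/-- `𝒟_Λ(R)` consists exactly of the tilings that the substitution rules produce from `R`. -/
theorem mem_vmdTilings_iff (R T : List Domino) :
    T ∈ vmdTilings R ↔ Relation.ReflTransGen Substitution R T := by
  constructor
  · intro h
    induction R using vmdTilings.induct generalizing T with
    | case1 =>
      simp only [vmdTilings, Finset.mem_singleton] at h
      exact h ▸ .refl
    | case2 t ih1 ih2 =>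
      rw [vmdTilings, Finset.mem_union, Finset.mem_image, Finset.mem_image] at h
      rcases h with ⟨S, hS, rfl⟩ | ⟨S, hS, rfl⟩
      · exact reflTransGen_cons _ (ih1 S hS)
      · exact .head (Substitution.dimer [] t) (reflTransGen_cons _ (ih2 S hS))
    | case3 t ih1 ih2 =>
      rw [vmdTilings, Finset.mem_union, Finset.mem_image, Finset.mem_image] at h
      rcases h with ⟨S, hS, rfl⟩ | ⟨S, hS, rfl⟩
      · exact reflTransGen_cons _ (ih1 S hS)
      · exact .head (Substitution.truncatedDimer1 [] t) (reflTransGen_cons _ (ih2 S hS))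
    | case4 t ih1 ih2 =>
      rw [vmdTilings, Finset.mem_union, Finset.mem_image, Finset.mem_image] at h
      rcases h with ⟨S, hS, rfl⟩ | ⟨S, hS, rfl⟩
      · exact reflTransGen_cons _ (ih1 S hS)
      · exact .head (Substitution.truncatedDimer2 [] t) (reflTransGen_cons _ (ih2 S hS))
    | case5 D t h1 h2 h3 ih =>
      rw [vmdTilings.eq_5 D t h1 h2 h3, Finset.mem_image] at h
      obtain ⟨S, hS, rfl⟩ := h
      exact reflTransGen_cons _ (ih S hS)
  · intro h
    induction h with
    | refl => exact self_mem_vmdTilings R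
    | tail _ hs ih => exact vmdTilings_step ih hs

/-! ### The VMD states -/

/-- The operator of a domino that starts at `x`, built from the creation operators `raise`
(`c^*` for fermions, `σ^+` for spins). The left boundary dimer has its particles at its first and
second site. -/
def dominoOp {Λ : Finset ℤ} (lam : ℂ) (raise : ℤ → Op Λ) (x : ℤ) : Domino → Op Λ
  | .void => 1
  | .monomer => raise x
  | .rightMonomer1 => raise x
  | .rightMonomer2 => raise x
  | .leftDimer => lam • (raise x * raise (x + 1))
  | .dimer => lam • (raise (x + 1) * raise (x + 2))
  | .rightDimer => lam • (raise (x + 1) * raise (x + 2))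
  | .truncatedDimer1 => lam • (raise (x + 1) * raise (x + 2))
  | .truncatedDimer2 => lam • (raise (x + 1) * raise (x + 2))

/-- The product `C_{D₁}^* ⋯ C_{D_N}^*` for consecutive dominoes `D₁, …, D_N`, the first of which
starts at the given site. -/
def tilingOp {Λ : Finset ℤ} (lam : ℂ) (raise : ℤ → Op Λ) : ℤ → List Domino → Op Λ
  | _, [] => 1
  | x, D :: T => dominoOp lam raise x D * tilingOp lam raise (x + D.length) T

/-- The vector `∑_{𝑫 ∈ 𝒟_Λ(R)} C_{D₁}^* ⋯ C_{D_N}^* |0⟩` for the interval `Λ = [a, b]`. -/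
def vmdVector (lam : ℂ) (a b : ℤ) (raise : ℤ → Op (Icc a b)) (R : List Domino) :
    Space (Icc a b) :=
  ∑ T ∈ vmdTilings R, tilingOp lam raise a T (vacuum (Icc a b))

/-- The fermionic VMD vector `ψ_Λ(R)`, `Λ = [a, b]`. -/
def fermionVMD (lam : ℂ) (a b : ℤ) (R : List Domino) : Space (Icc a b) :=
  vmdVector lam a b (creation (Icc a b)) R

/-- The VMD vector `ψ_Λ(R)`, `Λ = [a, b]`, of the spin chain. -/
def spinVMD (lam : ℂ) (a b : ℤ) (R : List Domino) : Space (Icc a b) :=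
  vmdVector lam a b (spinRaise (Icc a b)) R

/-- The vector state `A ↦ ⟨ψ/‖ψ‖, A ψ/‖ψ‖⟩` of a nonzero vector `ψ`. -/
def vectorState {Λ : Finset ℤ} (ψ : Space Λ) (A : Op Λ) : ℂ :=
  inner ℂ (((‖ψ‖⁻¹ : ℝ) : ℂ) • ψ) (A (((‖ψ‖⁻¹ : ℝ) : ℂ) • ψ))

/-! ### The decay rate -/

/-- The distance `min {|x - y| : x ∈ X, y ∈ Y}` of nonempty sets (and `0` if one is empty). -/
def siteDist (X Y : Finset ℤ) : ℕ := sInf {d | ∃ x ∈ X, ∃ y ∈ Y, d = (x - y).natAbs}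

/-- `c(λ) = (1/3) ln ((√(4|λ|² + 1) + 1) / (√(4|λ|² + 1) - 1))`, for `λ ≠ 0`. -/
def decayRate (lam : ℂ) : ℝ :=
  1 / 3 * Real.log ((√(4 * ‖lam‖ ^ 2 + 1) + 1) / (√(4 * ‖lam‖ ^ 2 + 1) - 1))

end

end VMD

namespace VMD

noncomputable section

variable {Λ : Finset ℤ}

/-- The action of an operator on wave functions `σ ↦ ⟨σ|ψ⟩`. -/
def act (A : Op Λ) (f : Config Λ → ℂ) : Config Λ → ℂ := (A (WithLp.toLp 2 f)).ofLp

theorem act_mul (A B : Op Λ) (f : Config Λ → ℂ) : act (A * B) f = act A (act B f) := rfl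

theorem act_one (f : Config Λ → ℂ) : act (1 : Op Λ) f = f := rfl

theorem act_add (A B : Op Λ) (f : Config Λ → ℂ) : act (A + B) f = act A f + act B f := rfl

theorem act_smul (c : ℂ) (A : Op Λ) (f : Config Λ → ℂ) : act (c • A) f = c • act A f := rfl

theorem act_zero_left (f : Config Λ → ℂ) : act (0 : Op Λ) f = 0 := rfl

theorem act_sum {ι : Type*} (A : Op Λ) (s : Finset ι) (f : ι → Config Λ → ℂ) :
    act A (∑ i ∈ s, f i) = ∑ i ∈ s, act A (f i) := by
  simp [act, WithLp.toLp_sum, WithLp.ofLp_sum, map_sum]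

theorem op_ext {A B : Op Λ} (h : ∀ f, act A f = act B f) : A = B := by
  ext f σ
  exact congrFun (h f.ofLp) σ

theorem act_opOfMatrix (M : Config Λ → Config Λ → ℂ) (f : Config Λ → ℂ) (σ : Config Λ) :
    act (opOfMatrix Λ M) f σ = ∑ τ, M σ τ * f τ := by
  simp [act, opOfMatrix, Matrix.toEuclideanCLM_toLp, Matrix.mulVec, dotProduct]

/-- `f` depends only on the occupation of the sites in `s`. -/
def SupportedOn (s : Set ℤ) (f : Config Λ → ℂ) : Prop :=
  ∀ σ τ : Config Λ, (∀ y : ↥Λ, (y : ℤ) ∈ s → σ y = τ y) → f σ = f τ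

theorem SupportedOn.mono {s t : Set ℤ} {f : Config Λ → ℂ} (hf : SupportedOn s f) (h : s ⊆ t) :
    SupportedOn t f :=
  fun σ τ hστ => hf σ τ fun y hy => hστ y (h hy)

theorem SupportedOn.mul {s : Set ℤ} {f g : Config Λ → ℂ} (hf : SupportedOn s f)
    (hg : SupportedOn s g) : SupportedOn s (f * g) := fun σ τ h => by
  simp [hf σ τ h, hg σ τ h]

theorem SupportedOn.add {s : Set ℤ} {f g : Config Λ → ℂ} (hf : SupportedOn s f)
    (hg : SupportedOn s g) : SupportedOn s (f + g) := fun σ τ h => by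
  simp [hf σ τ h, hg σ τ h]

theorem SupportedOn.smul {s : Set ℤ} {f : Config Λ → ℂ} (c : ℂ) (hf : SupportedOn s f) :
    SupportedOn s (c • f) := fun σ τ h => by
  simp [hf σ τ h]

theorem SupportedOn.star {s : Set ℤ} {f : Config Λ → ℂ} (hf : SupportedOn s f) :
    SupportedOn s (star f) := fun σ τ h => by
  simp [hf σ τ h]

theorem supportedOn_const {s : Set ℤ} (c : ℂ) : SupportedOn s (fun _ : Config Λ => c) :=
  fun _ _ _ => rfl

theorem supportedOn_one {s : Set ℤ} : SupportedOn s (1 : Config Λ → ℂ) := supportedOn_const 1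

theorem supportedOn_zero {s : Set ℤ} : SupportedOn s (0 : Config Λ → ℂ) := supportedOn_const 0

/-- The uniform average over all configurations. -/
def mean (f : Config Λ → ℂ) : ℂ := (∑ σ, f σ) / Fintype.card (Config Λ)

/-- The uniform average of `|f|²`. -/
def meanSq (f : Config Λ → ℂ) : ℝ := (∑ σ, ‖f σ‖ ^ 2) / Fintype.card (Config Λ)

theorem card_config_ne_zero : (Fintype.card (Config Λ) : ℂ) ≠ 0 := by
  exact_mod_cast Fintype.card_ne_zero

theorem mean_sum {ι : Type*} (s : Finset ι) (f : ι → Config Λ → ℂ) :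
    mean (∑ i ∈ s, f i) = ∑ i ∈ s, mean (f i) := by
  simp only [mean, Finset.sum_apply]
  rw [Finset.sum_comm, Finset.sum_div]

theorem mean_zero : mean (0 : Config Λ → ℂ) = 0 := by
  simp [mean]

theorem mean_one : mean (1 : Config Λ → ℂ) = 1 := by
  simp only [mean, Pi.one_apply, Finset.sum_const, Finset.card_univ, nsmul_eq_mul, mul_one]
  exact div_self card_config_ne_zero

theorem mean_star_mul_self (f : Config Λ → ℂ) : mean (star f * f) = meanSq f := by
  simp only [mean, meanSq, Pi.mul_apply, Pi.star_apply, RCLike.star_def, Complex.conj_mul']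
  push_cast
  rfl

theorem meanSq_nonneg (f : Config Λ → ℂ) : 0 ≤ meanSq f := by
  unfold meanSq
  positivity

/-- Functions of disjoint sets of sites are independent. -/
theorem mean_mul {s t : Set ℤ} {f g : Config Λ → ℂ} (hf : SupportedOn s f)
    (hg : SupportedOn t g) (h : Disjoint s t) : mean (f * g) = mean f * mean g := by
  classical
  have key : (∑ σ, f σ * g σ) * (Fintype.card (Config Λ) : ℂ) = (∑ σ, f σ) * ∑ σ, g σ := by
    let m : Config Λ → Config Λ → Config Λ := fun σ τ y => if (y : ℤ) ∈ s then σ y else τ y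
    let e : Config Λ × Config Λ ≃ Config Λ × Config Λ :=
      { toFun := fun p => (m p.1 p.2, m p.2 p.1)
        invFun := fun p => (m p.1 p.2, m p.2 p.1)
        left_inv := by
          rintro ⟨σ, τ⟩
          ext y <;> by_cases hy : (y : ℤ) ∈ s <;> simp [m, hy]
        right_inv := by
          rintro ⟨σ, τ⟩
          ext y <;> by_cases hy : (y : ℤ) ∈ s <;> simp [m, hy] }
    calc (∑ σ, f σ * g σ) * (Fintype.card (Config Λ) : ℂ)
        = ∑ p : Config Λ × Config Λ, f p.1 * g p.1 := by
          rw [Fintype.sum_prod_type, Finset.sum_mul]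
          refine Finset.sum_congr rfl fun σ _ => ?_
          simp [mul_comm]
      _ = ∑ p : Config Λ × Config Λ, f (e p).1 * g (e p).1 :=
          (Equiv.sum_comp e fun p => f p.1 * g p.1).symm
      _ = ∑ p : Config Λ × Config Λ, f p.1 * g p.2 := by
          refine Finset.sum_congr rfl fun p _ => ?_
          congr 1
          · exact hf _ _ fun y hy => by simp [e, m, hy]
          · exact hg _ _ fun y hy => by
              have : (y : ℤ) ∉ s := fun hs => Set.disjoint_left.1 h hs hy
              simp [e, m, this]
      _ = _ := by
          rw [Fintype.sum_prod_type, Finset.sum_mul_sum]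
  have hc := card_config_ne_zero (Λ := Λ)
  simp only [mean, Pi.mul_apply]
  field_simp
  linear_combination key

theorem meanSq_mul {s t : Set ℤ} {f g : Config Λ → ℂ} (hf : SupportedOn s f)
    (hg : SupportedOn t g) (h : Disjoint s t) : meanSq (f * g) = meanSq f * meanSq g := by
  have : (meanSq (f * g) : ℂ) = meanSq f * meanSq g := by
    rw [← mean_star_mul_self, ← mean_star_mul_self, ← mean_star_mul_self,
      ← mean_mul (hf.star.mul hf) (hg.star.mul hg) h]
    congr 1
    rw [star_mul']
    ring
  exact_mod_cast this

theorem meanSq_smul (c : ℂ) (f : Config Λ → ℂ) : meanSq (c • f) = ‖c‖ ^ 2 * meanSq f := by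
  simp [meanSq, mul_pow, ← Finset.mul_sum, mul_div_assoc]

theorem meanSq_one : meanSq (1 : Config Λ → ℂ) = 1 := by
  have := mean_star_mul_self (1 : Config Λ → ℂ)
  rw [star_one, one_mul, mean_one] at this
  exact_mod_cast this.symm

theorem meanSq_zero : meanSq (0 : Config Λ → ℂ) = 0 := by
  simp [meanSq]

theorem meanSq_add_of_mul_eq_zero {f g : Config Λ → ℂ} (h : f * g = 0) :
    meanSq (f + g) = meanSq f + meanSq g := by
  simp only [meanSq, ← add_div, ← Finset.sum_add_distrib]
  congr 1
  refine Finset.sum_congr rfl fun σ _ => ?_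
  rcases mul_eq_zero.1 (congrFun h σ) with h | h <;> simp [h]

theorem inner_eq_mean (ψ : Space Λ) (A : Op Λ) :
    inner ℂ ψ (A ψ) = Fintype.card (Config Λ) * mean (star ψ.ofLp * act A ψ.ofLp) := by
  rw [mean, mul_div_cancel₀ _ card_config_ne_zero, EuclideanSpace.inner_eq_star_dotProduct]
  simp [dotProduct, act, mul_comm]

theorem norm_sq_eq_meanSq (ψ : Space Λ) :
    ‖ψ‖ ^ 2 = Fintype.card (Config Λ) * meanSq ψ.ofLp := by
  rw [meanSq, mul_div_cancel₀ _ (by exact_mod_cast Fintype.card_ne_zero),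
    EuclideanSpace.norm_sq_eq]

theorem norm_mean_star_mul_act_le (A : Op Λ) (f : Config Λ → ℂ) :
    ‖mean (star f * act A f)‖ ≤ ‖A‖ * meanSq f := by
  have hc : (0 : ℝ) < Fintype.card (Config Λ) := by exact_mod_cast Fintype.card_pos
  have h1 := inner_eq_mean (WithLp.toLp 2 f) A
  have h2 := norm_sq_eq_meanSq (WithLp.toLp 2 f : Space Λ)
  have h3 := norm_inner_le_norm (𝕜 := ℂ) (WithLp.toLp 2 f : Space Λ) (A (WithLp.toLp 2 f))
  have h4 := A.le_opNorm (WithLp.toLp 2 f)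
  rw [h1, norm_mul, Complex.norm_natCast] at h3
  refine le_of_mul_le_mul_left ?_ hc
  calc _ ≤ _ := h3
    _ ≤ ‖(WithLp.toLp 2 f : Space Λ)‖ * (‖A‖ * ‖(WithLp.toLp 2 f : Space Λ)‖) := by gcongr
    _ = ‖A‖ * ‖(WithLp.toLp 2 f : Space Λ)‖ ^ 2 := by ring
    _ = _ := by rw [h2]; ring

theorem vectorState_eq (ψ : Space Λ) (A : Op Λ) :
    vectorState ψ A = mean (star ψ.ofLp * act A ψ.ofLp) / meanSq ψ.ofLp := by
  have hc := card_config_ne_zero (Λ := Λ)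
  have h2 : ((‖ψ‖ ^ 2 : ℝ) : ℂ) = Fintype.card (Config Λ) * meanSq ψ.ofLp := by
    rw [norm_sq_eq_meanSq]; push_cast; rfl
  rw [vectorState, map_smul, inner_smul_left, inner_smul_right, inner_eq_mean, Complex.conj_ofReal]
  push_cast at h2 ⊢
  rw [← mul_assoc, ← mul_inv, ← sq, h2, mul_inv, div_eq_mul_inv]
  field_simp

/-- `A` acts only on the sites in `X`. -/
structure IsLocal (X : Set ℤ) (A : Op Λ) : Prop where
  act_mul : ∀ f g, SupportedOn Xᶜ g → act A (f * g) = act A f * g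
  supportedOn : ∀ f s, X ⊆ s → SupportedOn s f → SupportedOn s (act A f)

theorem isLocal_one {X : Set ℤ} : IsLocal X (1 : Op Λ) :=
  ⟨fun _ _ _ => rfl, fun _ _ _ h => h⟩

theorem IsLocal.mul {X : Set ℤ} {A B : Op Λ} (hA : IsLocal X A) (hB : IsLocal X B) :
    IsLocal X (A * B) :=
  ⟨fun f g h => by rw [VMD.act_mul, hB.act_mul f g h, hA.act_mul _ g h, VMD.act_mul],
    fun f s hs h => hA.supportedOn _ s hs (hB.supportedOn f s hs h)⟩

theorem IsLocal.add {X : Set ℤ} {A B : Op Λ} (hA : IsLocal X A) (hB : IsLocal X B) :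
    IsLocal X (A + B) :=
  ⟨fun f g h => by rw [act_add, hB.act_mul f g h, hA.act_mul _ g h, act_add, add_mul],
    fun f s hs h => (hA.supportedOn f s hs h).add (hB.supportedOn f s hs h)⟩

theorem IsLocal.smul {X : Set ℤ} {A : Op Λ} (c : ℂ) (hA : IsLocal X A) : IsLocal X (c • A) :=
  ⟨fun f g h => by rw [act_smul, act_smul, hA.act_mul f g h, smul_mul_assoc],
    fun f s hs h => (hA.supportedOn f s hs h).smul c⟩

theorem isLocal_zero {X : Set ℤ} : IsLocal X (0 : Op Λ) :=
  ⟨fun f g _ => by rw [act_zero_left, act_zero_left, zero_mul], fun _ _ _ _ => supportedOn_zero⟩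

section Covariance

/-- For weights `p i * r j * z i j` on two two-valued variables, the covariance of a function of the
first and a function of the second variable is controlled by the determinant of `z`. -/
theorem covariance_le (p r : Fin 2 → ℝ) (z : Fin 2 → Fin 2 → ℝ) (a b : Fin 2 → ℂ) (α β κ : ℝ)
    (hp : ∀ i, 0 ≤ p i) (hr : ∀ j, 0 ≤ r j) (hz : ∀ i j, 0 ≤ z i j) (hα : 0 ≤ α) (hβ : 0 ≤ β)
    (hκ : 0 ≤ κ) (ha : ∀ i, ‖a i‖ ≤ α * p i) (hb : ∀ j, ‖b j‖ ≤ β * r j)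
    (hdet : |z 0 0 * z 1 1 - z 0 1 * z 1 0| ≤ κ * (z 0 1 * z 1 0)) :
    ‖(∑ i, ∑ j, a i * z i j * b j) / ((∑ i, ∑ j, p i * z i j * r j : ℝ) : ℂ) -
        (∑ i, ∑ j, a i * z i j * (r j : ℂ)) / ((∑ i, ∑ j, p i * z i j * r j : ℝ) : ℂ) *
          ((∑ i, ∑ j, (p i : ℂ) * z i j * b j) / ((∑ i, ∑ j, p i * z i j * r j : ℝ) : ℂ))‖ ≤
      κ * α * β := by
  set N : ℝ := ∑ i, ∑ j, p i * z i j * r j with hN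
  simp only [Fin.sum_univ_two] at hN ⊢
  have ht : ∀ i j, 0 ≤ p i * z i j * r j := fun i j =>
    mul_nonneg (mul_nonneg (hp i) (hz i j)) (hr j)
  rcases eq_or_ne N 0 with h0 | h0
  · simp [h0]
    positivity
  have hN0 : (N : ℂ) ≠ 0 := by exact_mod_cast h0
  have hNsq : 0 < N ^ 2 := by positivity
  have hbound : 4 * (p 0 * p 1 * (r 0 * r 1) * (z 0 1 * z 1 0)) ≤ N ^ 2 := by
    have h1 := ht 0 0
    have h2 := ht 0 1
    have h3 := ht 1 0
    have h4 := ht 1 1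
    have h5 : p 0 * z 0 1 * r 1 + p 1 * z 1 0 * r 0 ≤ N := by rw [hN]; linarith
    have h6 : (p 0 * z 0 1 * r 1 + p 1 * z 1 0 * r 0) ^ 2 ≤ N ^ 2 :=
      pow_le_pow_left₀ (by positivity) h5 2
    nlinarith [sq_nonneg (p 0 * z 0 1 * r 1 - p 1 * z 1 0 * r 0)]
  have hA : ‖a 0 * p 1 - a 1 * p 0‖ ≤ 2 * α * (p 0 * p 1) := by
    refine (norm_sub_le _ _).trans ?_
    rw [norm_mul, norm_mul, Complex.norm_of_nonneg (hp 0), Complex.norm_of_nonneg (hp 1)]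
    nlinarith [mul_le_mul_of_nonneg_right (ha 0) (hp 1), mul_le_mul_of_nonneg_right (ha 1) (hp 0)]
  have hB : ‖b 0 * r 1 - b 1 * r 0‖ ≤ 2 * β * (r 0 * r 1) := by
    refine (norm_sub_le _ _).trans ?_
    rw [norm_mul, norm_mul, Complex.norm_of_nonneg (hr 0), Complex.norm_of_nonneg (hr 1)]
    nlinarith [mul_le_mul_of_nonneg_right (hb 0) (hr 1), mul_le_mul_of_nonneg_right (hb 1) (hr 0)]
  have hD : ‖((z 0 0 * z 1 1 - z 0 1 * z 1 0 : ℝ) : ℂ)‖ ≤ κ * (z 0 1 * z 1 0) := by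
    rwa [Complex.norm_real, Real.norm_eq_abs]
  have e : ∀ u v w : ℂ, u / N - v / N * (w / N) = (u * N - v * w) / ((N ^ 2 : ℝ) : ℂ) := by
    intro u v w
    push_cast
    field_simp
  rw [e, norm_div, Complex.norm_of_nonneg hNsq.le, div_le_iff₀ hNsq]
  calc _ = ‖(a 0 * p 1 - a 1 * p 0) * (b 0 * r 1 - b 1 * r 0) *
            ((z 0 0 * z 1 1 - z 0 1 * z 1 0 : ℝ) : ℂ)‖ := by
        congr 1
        rw [hN]
        push_cast
        ring
    _ ≤ (2 * α * (p 0 * p 1)) * (2 * β * (r 0 * r 1)) * (κ * (z 0 1 * z 1 0)) := by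
        rw [norm_mul, norm_mul]
        have := hp 0; have := hp 1; have := hr 0; have := hr 1
        gcongr
    _ = κ * α * β * (4 * (p 0 * p 1 * (r 0 * r 1) * (z 0 1 * z 1 0))) := by ring
    _ ≤ κ * α * β * N ^ 2 := by gcongr

variable {X Y l m r : Set ℤ} {A B : Op Λ}

theorem act_act_mul (hA : IsLocal X A) (hB : IsLocal Y B) (hX : X ⊆ l) (hY : Y ⊆ r)
    (hlm : Disjoint l m) (hlr : Disjoint l r) (hmr : Disjoint m r) {φ ξ χ : Config Λ → ℂ}
    (hφ : SupportedOn l φ) (hξ : SupportedOn m ξ) (hχ : SupportedOn r χ) :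
    act A (act B (φ * ξ * χ)) = act A φ * ξ * act B χ ∧
      act B (act A (φ * ξ * χ)) = act A φ * ξ * act B χ := by
  have hlY : l ⊆ Yᶜ := (hlr.mono_right hY).subset_compl_right
  have hmY : m ⊆ Yᶜ := (hmr.mono_right hY).subset_compl_right
  have hmX : m ⊆ Xᶜ := (hlm.mono_left hX).symm.subset_compl_right
  have hrX : r ⊆ Xᶜ := (hlr.mono_left hX).symm.subset_compl_right
  have hAφ := hA.supportedOn φ l hX hφ
  have hBχ := hB.supportedOn χ r hY hχ
  constructor
  · rw [mul_comm _ χ, hB.act_mul χ _ ((hφ.mono hlY).mul (hξ.mono hmY)), mul_comm _ (φ * ξ),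
      mul_assoc, hA.act_mul φ _ ((hξ.mono hmX).mul (hBχ.mono hrX)), mul_assoc]
  · rw [mul_assoc φ, hA.act_mul φ _ ((hξ.mono hmX).mul (hχ.mono hrX)), ← mul_assoc,
      mul_comm _ χ, hB.act_mul χ _ ((hAφ.mono hlY).mul (hξ.mono hmY)), mul_comm (act B χ)]

theorem mean_star_mul_act_mul (hA : IsLocal X A) (hB : IsLocal Y B) (hX : X ⊆ l) (hY : Y ⊆ r)
    (hlm : Disjoint l m) (hlr : Disjoint l r) (hmr : Disjoint m r)
    {φ χ : Fin 2 → Config Λ → ℂ} {ξ : Fin 2 → Fin 2 → Config Λ → ℂ}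
    (hφ : ∀ i, SupportedOn l (φ i)) (hξ : ∀ i j, SupportedOn m (ξ i j))
    (hχ : ∀ j, SupportedOn r (χ j))
    (horth : ∀ i j i' j', (i, j) ≠ (i', j') → ξ i j * ξ i' j' = 0)
    {ψ : Config Λ → ℂ} (hψ : ψ = ∑ i, ∑ j, φ i * ξ i j * χ j) :
    mean (star ψ * act A (act B ψ)) =
        ∑ i, ∑ j, mean (star (φ i) * act A (φ i)) * meanSq (ξ i j) *
          mean (star (χ j) * act B (χ j)) ∧
      act A (act B ψ) = act B (act A ψ) := by
  have h := fun i j => act_act_mul hA hB hX hY hlm hlr hmr (hφ i) (hξ i j) (hχ j)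
  have hAB : act A (act B ψ) = ∑ i, ∑ j, act A (φ i) * ξ i j * act B (χ j) := by
    simp only [hψ, act_sum, (h _ _).1]
  have hBA : act B (act A ψ) = ∑ i, ∑ j, act A (φ i) * ξ i j * act B (χ j) := by
    simp only [hψ, act_sum, (h _ _).2]
  refine ⟨?_, hAB.trans hBA.symm⟩
  have horth' : ∀ i j i' j', (i, j) ≠ (i', j') → star (ξ i j) * ξ i' j' = 0 := by
    intro i j i' j' hne
    funext σ
    have := congrFun (horth i j i' j' hne) σ
    simp only [Pi.mul_apply, Pi.zero_apply, mul_eq_zero, Pi.star_apply, star_eq_zero] at this ⊢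
    exact this
  have hterm : ∀ i j i' j', star (φ i * ξ i j * χ j) * (act A (φ i') * ξ i' j' * act B (χ j')) =
      if (i, j) = (i', j') then
        (star (φ i) * act A (φ i)) * (star (ξ i j) * ξ i j) * (star (χ j) * act B (χ j))
      else 0 := by
    intro i j i' j'
    split_ifs with he
    · obtain ⟨rfl, rfl⟩ := Prod.mk.inj he
      rw [star_mul', star_mul']
      ring
    · rw [star_mul', star_mul', show star (φ i) * star (ξ i j) * star (χ j) *
        (act A (φ i') * ξ i' j' * act B (χ j')) = star (φ i) * star (χ j) * act A (φ i') *
          act B (χ j') * (star (ξ i j) * ξ i' j') by ring, horth' i j i' j' he, mul_zero]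
  have hsum : star ψ * act A (act B ψ) = ∑ i, ∑ j,
      (star (φ i) * act A (φ i)) * (star (ξ i j) * ξ i j) * (star (χ j) * act B (χ j)) := by
    rw [hAB, hψ]
    simp only [star_sum, Finset.sum_mul, Finset.mul_sum, hterm, Prod.mk.injEq]
    refine Finset.sum_congr rfl fun i _ => Finset.sum_congr rfl fun j _ => ?_
    fin_cases i <;> fin_cases j <;> simp
  rw [hsum]
  simp only [mean_sum]
  refine Finset.sum_congr rfl fun i _ => Finset.sum_congr rfl fun j _ => ?_
  have hl := (hφ i).star.mul (hA.supportedOn _ l hX (hφ i))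
  have hm := (hξ i j).star.mul (hξ i j)
  have hr := (hχ j).star.mul (hB.supportedOn _ r hY (hχ j))
  rw [mean_mul (s := l ∪ m) (t := r) ((hl.mono Set.subset_union_left).mul
      (hm.mono Set.subset_union_right)) hr (Set.disjoint_union_left.2 ⟨hlr, hmr⟩),
    mean_mul hl hm hlm, mean_star_mul_self]

theorem norm_covariance_le (hA : IsLocal X A) (hB : IsLocal Y B) (hX : X ⊆ l) (hY : Y ⊆ r)
    (hlm : Disjoint l m) (hlr : Disjoint l r) (hmr : Disjoint m r)
    {φ χ : Fin 2 → Config Λ → ℂ} {ξ : Fin 2 → Fin 2 → Config Λ → ℂ}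
    (hφ : ∀ i, SupportedOn l (φ i)) (hξ : ∀ i j, SupportedOn m (ξ i j))
    (hχ : ∀ j, SupportedOn r (χ j))
    (horth : ∀ i j i' j', (i, j) ≠ (i', j') → ξ i j * ξ i' j' = 0)
    {ψ : Space Λ} (hψ : ψ.ofLp = ∑ i, ∑ j, φ i * ξ i j * χ j) {κ : ℝ} (hκ : 0 ≤ κ)
    (hdet : |meanSq (ξ 0 0) * meanSq (ξ 1 1) - meanSq (ξ 0 1) * meanSq (ξ 1 0)| ≤
      κ * (meanSq (ξ 0 1) * meanSq (ξ 1 0))) :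
    ‖vectorState ψ (A * B) - vectorState ψ A * vectorState ψ B‖ ≤ κ * ‖A‖ * ‖B‖ ∧
      vectorState ψ (A * B) = vectorState ψ (B * A) := by
  have hAB := mean_star_mul_act_mul hA hB hX hY hlm hlr hmr hφ hξ hχ horth hψ
  have hA1 := mean_star_mul_act_mul hA isLocal_one hX hY hlm hlr hmr hφ hξ hχ horth hψ
  have h1B := mean_star_mul_act_mul isLocal_one hB hX hY hlm hlr hmr hφ hξ hχ horth hψ
  have h11 := mean_star_mul_act_mul isLocal_one isLocal_one hX hY hlm hlr hmr hφ hξ hχ horth hψ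
  simp only [act_one, mean_star_mul_self] at hA1 h1B h11
  have hN : meanSq ψ.ofLp = ∑ i, ∑ j, meanSq (φ i) * meanSq (ξ i j) * meanSq (χ j) := by
    exact_mod_cast h11.1
  constructor
  · rw [vectorState_eq, vectorState_eq, vectorState_eq, act_mul, hAB.1, hA1.1, h1B.1, hN]
    exact covariance_le _ _ _ _ _ _ _ _ (fun _ => meanSq_nonneg _) (fun _ => meanSq_nonneg _)
      (fun _ _ => meanSq_nonneg _) (norm_nonneg A) (norm_nonneg B) hκ
      (fun _ => norm_mean_star_mul_act_le _ _) (fun _ => norm_mean_star_mul_act_le _ _) hdet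
  · rw [vectorState_eq, vectorState_eq, act_mul, act_mul, hAB.2]

end Covariance

/-- The occupation numbers of the sites of a domino. -/
def Domino.word : Domino → List Bool
  | .void => [false]
  | .monomer => [true, false, false]
  | .dimer => [false, true, true, false, false, false]
  | .leftDimer => [true, true, false, false, false]
  | .rightDimer => [false, true, true]
  | .rightMonomer1 => [true]
  | .rightMonomer2 => [true, false]
  | .truncatedDimer1 => [false, true, true, false]
  | .truncatedDimer2 => [false, true, true, false, false]

theorem Domino.length_word (D : Domino) : D.word.length = D.length := by
  cases D <;> rfl

/-- The coefficient of a domino. -/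
def Domino.weight (lam : ℂ) : Domino → ℂ
  | .void => 1
  | .monomer => 1
  | .rightMonomer1 => 1
  | .rightMonomer2 => 1
  | _ => lam

/-- The number of sites that a list of dominoes covers. -/
def coverLength (T : List Domino) : ℕ := (T.map Domino.length).sum

@[simp] theorem coverLength_nil : coverLength [] = 0 := rfl

@[simp] theorem coverLength_cons (D : Domino) (T : List Domino) :
    coverLength (D :: T) = D.length + coverLength T := by
  simp [coverLength]

@[simp] theorem coverLength_append (S T : List Domino) :
    coverLength (S ++ T) = coverLength S + coverLength T := by
  simp [coverLength]

/-- The occupation numbers of the sites of consecutive dominoes. -/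
def tilingWord (T : List Domino) : List Bool := (T.map Domino.word).flatten

@[simp] theorem tilingWord_cons (D : Domino) (T : List Domino) :
    tilingWord (D :: T) = D.word ++ tilingWord T := by
  simp [tilingWord]

theorem length_tilingWord (T : List Domino) : (tilingWord T).length = coverLength T := by
  induction T with
  | nil => rfl
  | cons D T ih => simp [ih, Domino.length_word]

/-- The coefficient of a tiling. -/
def tilingWeight (lam : ℂ) (T : List Domino) : ℂ := (T.map (Domino.weight lam)).prod

@[simp] theorem tilingWeight_cons (lam : ℂ) (D : Domino) (T : List Domino) :
    tilingWeight lam (D :: T) = D.weight lam * tilingWeight lam T := by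
  simp [tilingWeight]

/-- The configuration with the occupation numbers `w` at `x, x + 1, …`, empty elsewhere. -/
def wordConfig : ℤ → List Bool → Config Λ
  | _, [] => fun _ => false
  | x, b :: w => fun y => if (y : ℤ) = x then b else wordConfig (x + 1) w y

theorem wordConfig_of_lt (w : List Bool) (x : ℤ) (y : ↥Λ) (h : (y : ℤ) < x) :
    wordConfig x w y = false := by
  induction w generalizing x with
  | nil => rfl
  | cons b w ih =>
    change (if (y : ℤ) = x then b else wordConfig (x + 1) w y) = false
    rw [if_neg (by omega), ih _ (by omega)]

theorem wordConfig_cons_false (w : List Bool) (x : ℤ) :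
    (wordConfig x (false :: w) : Config Λ) = wordConfig (x + 1) w := by
  funext y
  change (if (y : ℤ) = x then false else wordConfig (x + 1) w y) = _
  split_ifs with h
  · rw [wordConfig_of_lt _ _ _ (by omega)]
  · rfl

theorem wordConfig_cons_true (w : List Bool) (x : ℤ) (hx : x ∈ Λ) :
    (wordConfig x (true :: w) : Config Λ) =
      Function.update (wordConfig (x + 1) w) ⟨x, hx⟩ true := by
  funext y
  rw [wordConfig, Function.update_apply]
  simp only [Subtype.ext_iff]

/-- The operators `raise x` add a particle to the left of all others, with coefficient `1`. -/
def IsRaising (raise : ℤ → Op Λ) : Prop :=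
  ∀ (x : ℤ) (hx : x ∈ Λ) (τ : Config Λ), (∀ y : ↥Λ, (y : ℤ) ≤ x → τ y = false) →
    raise x (EuclideanSpace.single τ 1) =
      EuclideanSpace.single (Function.update τ ⟨x, hx⟩ true) 1

theorem IsRaising.apply_wordConfig {raise : ℤ → Op Λ} (h : IsRaising raise) {x : ℤ} (hx : x ∈ Λ)
    (w : List Bool) :
    raise x (EuclideanSpace.single (wordConfig (x + 1) w) 1) =
      EuclideanSpace.single (wordConfig x (true :: w)) 1 := by
  rw [h x hx _ fun y hy => wordConfig_of_lt _ _ _ (by omega), wordConfig_cons_true w x hx]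

theorem dominoOp_single {a b : ℤ} {raise : ℤ → Op (Icc a b)} (h : IsRaising raise) (lam : ℂ)
    (D : Domino) {x : ℤ} (hx : a ≤ x) (hx' : x + D.length ≤ b + 1) (w : List Bool) :
    dominoOp lam raise x D (EuclideanSpace.single (wordConfig (x + D.length) w) 1) =
      D.weight lam • EuclideanSpace.single (wordConfig x (D.word ++ w)) 1 := by
  have e2 : x + 1 + 1 = x + 2 := by ring
  have e3 : x + 2 + 1 = x + 3 := by ring
  have e4 : x + 3 + 1 = x + 4 := by ring
  have e5 : x + 4 + 1 = x + 5 := by ring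
  have e6 : x + 5 + 1 = x + 6 := by ring
  have r0 : ∀ v, x ≤ b → raise x (EuclideanSpace.single (wordConfig (x + 1) v) 1) =
      EuclideanSpace.single (wordConfig x (true :: v)) 1 := fun v hb =>
    h.apply_wordConfig (mem_Icc.2 ⟨hx, hb⟩) v
  have r1 : ∀ v, x + 1 ≤ b → raise (x + 1) (EuclideanSpace.single (wordConfig (x + 2) v) 1) =
      EuclideanSpace.single (wordConfig (x + 1) (true :: v)) 1 := fun v hb => by
    rw [← e2]
    exact h.apply_wordConfig (mem_Icc.2 ⟨by omega, hb⟩) v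
  have r2 : ∀ v, x + 2 ≤ b → raise (x + 2) (EuclideanSpace.single (wordConfig (x + 3) v) 1) =
      EuclideanSpace.single (wordConfig (x + 2) (true :: v)) 1 := fun v hb => by
    rw [← e3]
    exact h.apply_wordConfig (mem_Icc.2 ⟨by omega, hb⟩) v
  cases D <;> simp only [Domino.length, Nat.cast_ofNat, Nat.cast_one] at hx' ⊢ <;>
    simp only [Domino.weight, Domino.word, dominoOp, List.cons_append, List.nil_append,
      _root_.smul_apply, mul_apply_eq_comp, one_apply_eq_self,
      one_smul]
  · rw [wordConfig_cons_false]
  · rw [← r0 _ (by omega), wordConfig_cons_false, e2, wordConfig_cons_false, e3]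
  · rw [wordConfig_cons_false, ← r1 _ (by omega), ← r2 _ (by omega), wordConfig_cons_false, e4,
      wordConfig_cons_false, e5, wordConfig_cons_false, e6]
  · rw [← r0 _ (by omega), ← r1 _ (by omega), wordConfig_cons_false, e3, wordConfig_cons_false, e4,
      wordConfig_cons_false, e5]
  · rw [wordConfig_cons_false, ← r1 _ (by omega), ← r2 _ (by omega)]
  · rw [← r0 _ (by omega)]
  · rw [← r0 _ (by omega), wordConfig_cons_false, e2]
  · rw [wordConfig_cons_false, ← r1 _ (by omega), ← r2 _ (by omega), wordConfig_cons_false, e4]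
  · rw [wordConfig_cons_false, ← r1 _ (by omega), ← r2 _ (by omega), wordConfig_cons_false, e4,
      wordConfig_cons_false, e5]

theorem tilingOp_vacuum {a b : ℤ} {raise : ℤ → Op (Icc a b)} (h : IsRaising raise) (lam : ℂ)
    (T : List Domino) {x : ℤ} (hx : a ≤ x) (hx' : x + coverLength T ≤ b + 1) :
    tilingOp lam raise x T (vacuum (Icc a b)) =
      tilingWeight lam T • EuclideanSpace.single (wordConfig x (tilingWord T)) 1 := by
  induction T generalizing x with
  | nil => simp [tilingOp, tilingWeight, tilingWord, vacuum, wordConfig]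
  | cons D T ih =>
    rw [coverLength_cons] at hx'
    push_cast at hx'
    rw [tilingOp, mul_apply_eq_comp, ih (by omega) (by omega), map_smul,
      dominoOp_single h lam D hx (by omega), tilingWeight_cons, tilingWord_cons, smul_smul,
      mul_comm]

/-- The indicator function of `σ x = b` (and `1` if `x ∉ Λ`). -/
def siteInd (x : ℤ) (b : Bool) : Config Λ → ℂ := fun σ => if ∀ h : x ∈ Λ, σ ⟨x, h⟩ = b then 1 else 0

/-- The indicator function of the occupation numbers `w` at `x, x + 1, …`. -/
def pattern : ℤ → List Bool → Config Λ → ℂ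
  | _, [] => 1
  | x, b :: w => siteInd x b * pattern (x + 1) w

theorem pattern_append (x : ℤ) (v w : List Bool) :
    (pattern x (v ++ w) : Config Λ → ℂ) = pattern x v * pattern (x + v.length) w := by
  induction v generalizing x with
  | nil => simp [pattern]
  | cons b v ih =>
    rw [List.cons_append, pattern, pattern, ih, List.length_cons]
    push_cast
    rw [mul_assoc, show x + 1 + (v.length : ℤ) = x + (v.length + 1) by ring]

theorem pattern_eq_ite (x : ℤ) (w : List Bool) (σ : Config Λ) :
    pattern x w σ = if ∀ y : ↥Λ, x ≤ y → y < x + w.length → σ y = wordConfig x w y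
      then 1 else 0 := by
  induction w generalizing x with
  | nil =>
    rw [pattern, if_pos]
    · rfl
    · intro y h1 h2
      simp only [List.length_nil, Nat.cast_zero] at h2
      omega
  | cons b w ih =>
    rw [pattern, Pi.mul_apply, ih, siteInd, ite_mul, one_mul, zero_mul, ← ite_and]
    congr 1
    rw [eq_iff_iff]
    simp only [List.length_cons, Nat.cast_add, Nat.cast_one, wordConfig]
    constructor
    · rintro ⟨h1, h2⟩ y hy hy'
      split_ifs with h
      · subst h
        exact h1 y.2
      · exact h2 y (by omega) (by omega)
    · intro h
      refine ⟨fun hx => ?_, fun y hy hy' => ?_⟩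
      · have := h ⟨x, hx⟩ le_rfl (by simp only; omega)
        simpa using this
      · have := h y (by omega) (by omega)
        rwa [if_neg (by omega)] at this

theorem coverLength_of_mem_vmdTilings {R T : List Domino} (h : T ∈ vmdTilings R) :
    coverLength T = coverLength R := by
  rw [mem_vmdTilings_iff] at h
  induction h with
  | refl => rfl
  | tail _ hs ih =>
    rw [← ih]
    cases hs <;> simp [Domino.length, ← add_assoc]

/-- The weight of the substitution of two adjacent root dominoes by a (truncated) dimer. -/
def bond (lam : ℂ) : Domino → Domino → ℂ
  | .monomer, .monomer => lam
  | .monomer, .rightMonomer1 => lam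
  | .monomer, .rightMonomer2 => lam
  | _, _ => 0

theorem bond_eq_zero {lam : ℂ} {D E : Domino}
    (h : D ≠ .monomer ∨ E ≠ .monomer ∧ E ≠ .rightMonomer1 ∧ E ≠ .rightMonomer2) :
    bond lam D E = 0 := by
  cases D <;> cases E <;> simp_all [bond]

/-- The wave function of the dominoes of a root tiling that starts at `x`, and its substitutions. -/
def amp (lam : ℂ) : List Domino → ℤ → Config Λ → ℂ
  | [], _ => 1
  | [D], x => D.weight lam • pattern x D.word
  | D :: E :: R, x =>
      D.weight lam • pattern x D.word * amp lam (E :: R) (x + D.length) +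
        bond lam D E • (pattern x [false, true, true] *
          pattern (x + D.length) (List.replicate E.length false)) *
            amp lam R (x + D.length + E.length)

theorem amp_cons_of_bond (lam : ℂ) (D : Domino) (R : List Domino) (x : ℤ)
    (h : ∀ E S, R = E :: S → bond lam D E = 0) :
    (amp lam (D :: R) x : Config Λ → ℂ) =
      D.weight lam • pattern x D.word * amp lam R (x + D.length) := by
  rcases R with _ | ⟨E, S⟩
  · simp [amp]
  · rw [amp, h E S rfl, zero_smul, zero_mul, add_zero]

theorem sum_vmdTilings_eq_amp (lam : ℂ) (R : List Domino) (x : ℤ) :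
    ∑ T ∈ vmdTilings R, tilingWeight lam T • (pattern x (tilingWord T) : Config Λ → ℂ) =
      amp lam R x := by
  have hcons : ∀ (S : List Domino) (D : Domino) (x : ℤ),
      ∑ T ∈ (vmdTilings S).image (List.cons D),
        tilingWeight lam T • (pattern x (tilingWord T) : Config Λ → ℂ) =
      D.weight lam • pattern x D.word * ∑ T ∈ vmdTilings S,
        tilingWeight lam T • (pattern (x + D.length) (tilingWord T) : Config Λ → ℂ) := by
    intro S D x
    rw [Finset.sum_image fun _ _ _ _ h => (List.cons.inj h).2, Finset.mul_sum]
    refine Finset.sum_congr rfl fun T _ => ?_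
    rw [tilingWeight_cons, tilingWord_cons, pattern_append, Domino.length_word, smul_mul_smul_comm]
  have hdisj : ∀ (S S' : List Domino) (D D' : Domino), D ≠ D' →
      Disjoint ((vmdTilings S).image (List.cons D)) ((vmdTilings S').image (List.cons D')) := by
    intro S S' D D' hne
    rw [Finset.disjoint_left]
    intro T h h'
    obtain ⟨U, _, rfl⟩ := Finset.mem_image.1 h
    obtain ⟨U', _, hU'⟩ := Finset.mem_image.1 h'
    exact hne (List.cons.inj hU').1.symm
  induction R using vmdTilings.induct generalizing x with
  | case1 => simp [vmdTilings, amp, tilingWeight, tilingWord, pattern]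
  | case2 t ih1 ih2 =>
    rw [vmdTilings, Finset.sum_union (hdisj _ _ _ _ (by simp)), hcons, hcons, ih1, ih2, amp]
    congr 2
    · simp only [Domino.weight, bond]
      rw [show Domino.dimer.word = [false, true, true] ++ [false, false, false] from rfl,
        pattern_append]
      rfl
    · simp only [Domino.length, add_assoc]
      norm_num
  | case3 t ih1 ih2 =>
    rw [vmdTilings, Finset.sum_union (hdisj _ _ _ _ (by simp)), hcons, hcons, ih1, ih2, amp]
    congr 2
    · simp only [Domino.weight, bond]
      rw [show Domino.truncatedDimer1.word = [false, true, true] ++ [false] from rfl,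
        pattern_append]
      rfl
    · simp only [Domino.length, add_assoc]
      norm_num
  | case4 t ih1 ih2 =>
    rw [vmdTilings, Finset.sum_union (hdisj _ _ _ _ (by simp)), hcons, hcons, ih1, ih2, amp]
    congr 2
    · simp only [Domino.weight, bond]
      rw [show Domino.truncatedDimer2.word = [false, true, true] ++ [false, false] from rfl,
        pattern_append]
      rfl
    · simp only [Domino.length, add_assoc]
      norm_num
  | case5 D t h1 h2 h3 ih =>
    rw [vmdTilings.eq_5 D t h1 h2 h3, hcons, ih, amp_cons_of_bond]
    rintro E S rfl
    cases D <;> cases E <;> simp_all [bond]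

theorem vmdVector_eq_amp {a b : ℤ} {raise : ℤ → Op (Icc a b)} (h : IsRaising raise) (lam : ℂ)
    {R : List Domino} (hR : coverLength R = #(Icc a b)) :
    (vmdVector lam a b raise R).ofLp = amp lam R a := by
  rw [← sum_vmdTilings_eq_amp, vmdVector, WithLp.ofLp_sum]
  refine Finset.sum_congr rfl fun T hT => ?_
  have hT' := (coverLength_of_mem_vmdTilings hT).trans hR
  rw [Int.card_Icc] at hT'
  rcases eq_or_ne T [] with rfl | hne
  · have : (b + 1 - a).toNat = 0 := hT'.symm
    funext σ
    have : IsEmpty ↥(Icc a b) := ⟨fun y => by have := mem_Icc.1 y.2; omega⟩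
    have hs : σ = fun _ => false := Subsingleton.elim _ _
    simp [tilingOp, tilingWeight, tilingWord, pattern, vacuum, hs]
  have hpos : 0 < coverLength T := by
    obtain ⟨D, S, rfl⟩ := List.exists_cons_of_ne_nil hne
    rw [coverLength_cons]
    cases D <;> simp [Domino.length]
  rw [tilingOp_vacuum h lam T le_rfl (by omega), WithLp.ofLp_smul]
  congr 1
  funext σ
  rw [pattern_eq_ite, length_tilingWord]
  simp only [PiLp.ofLp_single, Pi.single_apply]
  congr 1
  rw [eq_iff_iff]
  constructor
  · rintro rfl y _ _
    rfl
  · intro hy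
    funext y
    have := mem_Icc.1 y.2
    exact hy y (by omega) (by omega)

theorem supportedOn_siteInd (x : ℤ) (b : Bool) : SupportedOn {x} (siteInd x b : Config Λ → ℂ) := by
  intro σ τ h
  simp only [siteInd]
  congr 1
  rw [eq_iff_iff]
  exact forall_congr' fun hx => by rw [h ⟨x, hx⟩ rfl]

theorem supportedOn_pattern (x : ℤ) (w : List Bool) :
    SupportedOn (Set.Ico x (x + w.length)) (pattern x w : Config Λ → ℂ) := by
  induction w generalizing x with
  | nil => exact supportedOn_one
  | cons b w ih =>
    refine ((supportedOn_siteInd x b).mono ?_).mul ((ih (x + 1)).mono ?_)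
    · rintro _ rfl
      simp only [List.length_cons, Set.mem_Ico]
      omega
    · intro y hy
      simp only [List.length_cons, Set.mem_Ico] at hy ⊢
      omega

theorem supportedOn_pattern_word (x : ℤ) (D : Domino) :
    SupportedOn (Set.Ico x (x + D.length)) (pattern x D.word : Config Λ → ℂ) := by
  rw [← D.length_word]
  exact supportedOn_pattern x _

theorem supportedOn_amp (lam : ℂ) : ∀ (R : List Domino) (x : ℤ),
    SupportedOn (Set.Ico x (x + coverLength R)) (amp lam R x : Config Λ → ℂ)
  | [], x => supportedOn_one
  | [D], x => by
    simpa [amp] using (supportedOn_pattern_word x D).smul (D.weight lam)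
  | D :: E :: R, x => by
    have h1 := supportedOn_amp lam (E :: R) (x + D.length)
    have h2 := supportedOn_amp lam R (x + D.length + E.length)
    simp only [coverLength_cons, Nat.cast_add] at h1 ⊢
    rw [amp]
    refine SupportedOn.add ((((supportedOn_pattern_word x D).smul _).mono ?_).mul (h1.mono ?_)) ?_
    · exact Set.Ico_subset_Ico_right (by omega)
    · exact Set.Ico_subset_Ico (by omega) (by omega)
    by_cases hD : D = .monomer
    · subst hD
      have hp := supportedOn_pattern (Λ := Λ) x [false, true, true]
      have hq := supportedOn_pattern (Λ := Λ) (x + Domino.monomer.length)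
        (List.replicate E.length false)
      simp only [List.length_cons, List.length_nil, Nat.cast_ofNat, Domino.length,
        List.length_replicate] at h1 h2 hp hq ⊢
      refine (((hp.mono ?_).mul (hq.mono ?_)).smul _).mul (h2.mono ?_)
      · exact Set.Ico_subset_Ico (by omega) (by omega)
      · exact Set.Ico_subset_Ico (by omega) (by omega)
      · exact Set.Ico_subset_Ico (by omega) (by omega)
    · rw [bond_eq_zero (Or.inl hD), zero_smul, zero_mul]
      exact supportedOn_zero

/-- Cutting a root tiling between the dominoes `D` and `E`: either no substitution crosses the cut,
or `D` and `E` are substituted by a (truncated) dimer. -/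
theorem amp_cut (lam : ℂ) (D E : Domino) (R : List Domino) : ∀ (L : List Domino) (x : ℤ),
    (amp lam (L ++ D :: E :: R) x : Config Λ → ℂ) =
      amp lam (L ++ [D]) x * amp lam (E :: R) (x + coverLength L + D.length) +
        (bond lam D E • (amp lam L x * pattern (x + coverLength L) [false, true, true])) *
          (pattern (x + coverLength L + D.length) (List.replicate E.length false) *
            amp lam R (x + coverLength L + D.length + E.length))
  | [], x => by
    simp only [List.nil_append, amp, coverLength_nil, Nat.cast_zero, add_zero, one_mul,
      smul_mul_assoc, mul_assoc]
  | [C], x => by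
    have h := amp_cut lam D E R [] (x + C.length)
    simp only [List.nil_append, coverLength_nil, Nat.cast_zero, add_zero] at h
    simp only [List.cons_append, List.nil_append, coverLength_cons, coverLength_nil, add_zero]
    rw [amp.eq_3 lam x C D, h]
    simp only [amp, smul_mul_assoc, mul_one, one_mul]
    simp only [mul_add, add_mul, smul_mul_assoc, mul_smul_comm, smul_add, ← mul_assoc]
    rw [smul_comm (C.weight lam) (bond lam D E)]
    abel
  | B :: C :: L, x => by
    have h1 := amp_cut lam D E R (C :: L) (x + B.length)
    have h2 := amp_cut lam D E R L (x + B.length + C.length)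
    simp only [List.cons_append, coverLength_cons, Nat.cast_add, ← add_assoc] at h1 ⊢
    rw [amp, h1, h2, amp, amp]
    simp only [mul_add, add_mul, smul_mul_assoc, mul_smul_comm, smul_add, ← mul_assoc]
    abel

theorem amp_append_void (lam : ℂ) (L R : List Domino) (x : ℤ) :
    (amp lam (L ++ .void :: R) x : Config Λ → ℂ) =
      amp lam L x * amp lam (.void :: R) (x + coverLength L) := by
  rcases List.eq_nil_or_concat L with rfl | ⟨L, D, rfl⟩
  · simp [amp]
  · have := amp_cut lam D .void R L x (Λ := Λ)
    rw [bond_eq_zero (Or.inr (by simp)), zero_smul, zero_mul, add_zero] at this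
    simp only [List.concat_eq_append, List.append_assoc, List.cons_append, List.nil_append,
      coverLength_append, coverLength_cons, coverLength_nil, add_zero, Nat.cast_add, ← add_assoc]
    exact this

theorem siteInd_mul_siteInd {x : ℤ} (hx : x ∈ Λ) {b c : Bool} (h : b ≠ c) :
    (siteInd x b * siteInd x c : Config Λ → ℂ) = 0 := by
  funext σ
  simp only [Pi.mul_apply, siteInd, Pi.zero_apply, mul_eq_zero, ite_eq_right_iff, one_ne_zero,
    imp_false]
  by_contra! hbc
  exact h ((hbc.1 hx).symm.trans (hbc.2 hx))

theorem pattern_mul_pattern {x : ℤ} {v w : List Bool} (hlen : v.length = w.length) (hne : v ≠ w)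
    (hΛ : ∀ y, x ≤ y → y < x + w.length → y ∈ Λ) :
    (pattern x v * pattern x w : Config Λ → ℂ) = 0 := by
  induction w generalizing x v with
  | nil => simp_all
  | cons c w ih =>
    obtain ⟨b, v, rfl⟩ := List.exists_cons_of_length_eq_add_one hlen
    simp only [List.length_cons, Nat.cast_add, Nat.cast_one] at hΛ
    rw [pattern, pattern, mul_mul_mul_comm]
    by_cases hbc : b = c
    · rw [ih (by simpa using hlen) (by simp_all) fun y h1 h2 => hΛ y (by omega) (by omega),
        mul_zero]
    · rw [siteInd_mul_siteInd (hΛ x le_rfl (by omega)) hbc, zero_mul]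

theorem meanSq_siteInd {x : ℤ} (hx : x ∈ Λ) (b : Bool) :
    meanSq (siteInd x b : Config Λ → ℂ) = 1 / 2 := by
  have hinv : Function.Involutive fun σ : Config Λ =>
      Function.update σ ⟨x, hx⟩ (!σ ⟨x, hx⟩) := fun σ => by simp
  have hflip : meanSq (siteInd x true : Config Λ → ℂ) =
      meanSq (siteInd x false : Config Λ → ℂ) := by
    simp only [meanSq]
    congr 1
    rw [← Equiv.sum_comp hinv.toPerm]
    refine Finset.sum_congr rfl fun σ _ => ?_
    simp [siteInd, hx]
  have hsum : (siteInd x true + siteInd x false : Config Λ → ℂ) = 1 := by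
    funext σ
    cases h : σ ⟨x, hx⟩ <;> simp [siteInd, hx, h]
  have := meanSq_add_of_mul_eq_zero (siteInd_mul_siteInd hx (b := true) (c := false) (by simp))
  rw [hsum, meanSq_one] at this
  cases b <;> linarith

theorem meanSq_pattern {x : ℤ} {w : List Bool} (hΛ : ∀ y, x ≤ y → y < x + w.length → y ∈ Λ) :
    meanSq (pattern x w : Config Λ → ℂ) = (1 / 2) ^ w.length := by
  induction w generalizing x with
  | nil => simp [pattern, meanSq_one]
  | cons b w ih =>
    simp only [List.length_cons, Nat.cast_add, Nat.cast_one] at hΛ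
    rw [pattern, meanSq_mul (supportedOn_siteInd x b) (supportedOn_pattern (x + 1) w),
      meanSq_siteInd (hΛ x le_rfl (by omega)), ih fun y h1 h2 => hΛ y (by omega) (by omega),
      List.length_cons, pow_succ']
    simp

/-- The squared norm of the vector of `n` adjacent monomers, where `μ = |λ|²`. -/
def chainNormSq (μ : ℝ) : ℕ → ℝ
  | 0 => 1
  | 1 => 1
  | n + 2 => chainNormSq μ (n + 1) + μ * chainNormSq μ n

theorem chainNormSq_nonneg {μ : ℝ} (hμ : 0 ≤ μ) : ∀ n, 0 ≤ chainNormSq μ n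
  | 0 => zero_le_one
  | 1 => zero_le_one
  | _ + 2 => add_nonneg (chainNormSq_nonneg hμ _) (mul_nonneg hμ (chainNormSq_nonneg hμ _))

theorem chainNormSq_det (μ : ℝ) (n : ℕ) :
    chainNormSq μ (n + 2) * chainNormSq μ n - chainNormSq μ (n + 1) ^ 2 =
      (-1) ^ n * μ ^ (n + 1) := by
  induction n with
  | zero => simp [chainNormSq]
  | succ n ih =>
    have h1 : chainNormSq μ (n + 1 + 2) = chainNormSq μ (n + 2) + μ * chainNormSq μ (n + 1) := rfl
    have h2 : chainNormSq μ (n + 2) = chainNormSq μ (n + 1) + μ * chainNormSq μ n := rfl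
    rw [h1, show n + 1 + 1 = n + 2 from rfl, pow_succ, pow_succ μ]
    rw [h2] at ih ⊢
    linear_combination (-μ) * ih

theorem chainNormSq_mul_eq {μ β γ : ℝ} (hsum : β + γ = 1) (hprod : β * γ = -μ) :
    ∀ n, chainNormSq μ n * (β - γ) = β ^ (n + 1) - γ ^ (n + 1)
  | 0 => by simp [chainNormSq]
  | 1 => by
    simp only [chainNormSq]
    linear_combination (γ - β) * hsum
  | n + 2 => by
    have h1 := chainNormSq_mul_eq hsum hprod (n + 1)
    have h2 := chainNormSq_mul_eq hsum hprod n
    rw [chainNormSq]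
    linear_combination h1 + μ * h2 - (β ^ (n + 2) - γ ^ (n + 2)) * hsum -
      (γ ^ (n + 1) - β ^ (n + 1)) * hprod

/-- The decay of the normalized determinant for an even number of monomers. -/
theorem pow_le_chainNormSq_sq {μ : ℝ} (hμ : 0 ≤ μ) (k : ℕ) :
    μ ^ (2 * k) ≤
      4 * ((√(4 * μ + 1) - 1) / (√(4 * μ + 1) + 1)) ^ (2 * k) * chainNormSq μ (2 * k) ^ 2 := by
  set s := √(4 * μ + 1) with hs
  have hs2 : s ^ 2 = 4 * μ + 1 := Real.sq_sqrt (by positivity)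
  have hs1 : 1 ≤ s := by
    rw [hs]
    exact Real.one_le_sqrt.2 (by linarith)
  have hZ := chainNormSq_mul_eq (μ := μ) (β := (1 + s) / 2) (γ := (1 - s) / 2) (by ring)
    (by linear_combination (-1 / 4) * hs2) (2 * k)
  have hγ : ((1 - s) / 2) ^ (2 * k + 1) ≤ 0 := by
    rw [pow_succ, pow_mul]
    exact mul_nonpos_of_nonneg_of_nonpos (by positivity) (by linarith)
  have hβ : 0 < (1 + s) / 2 := by linarith
  set B := ((1 + s) / 2) ^ (2 * k) with hB
  have hB0 : 0 < B := by positivity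
  have hle : B ≤ 2 * chainNormSq μ (2 * k) := by
    have h1 : B * ((1 + s) / 2) ≤ chainNormSq μ (2 * k) * s := by
      rw [hB, ← pow_succ]
      linarith
    have h2 : B * (s / 2) ≤ chainNormSq μ (2 * k) * s :=
      le_trans (mul_le_mul_of_nonneg_left (by linarith) hB0.le) h1
    nlinarith
  have hq : μ = (s - 1) / (s + 1) * ((1 + s) / 2) ^ 2 := by
    have : s + 1 ≠ 0 := by linarith
    field_simp
    linear_combination (-(s + 1)) * hs2
  have hq0 : 0 ≤ (s - 1) / (s + 1) := div_nonneg (by linarith) (by linarith)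
  calc μ ^ (2 * k) = ((s - 1) / (s + 1)) ^ (2 * k) * B ^ 2 := by
        conv_lhs => rw [hq]
        rw [mul_pow, hB, ← pow_mul, ← pow_mul, mul_comm 2 (2 * k)]
    _ ≤ ((s - 1) / (s + 1)) ^ (2 * k) * (2 * chainNormSq μ (2 * k)) ^ 2 := by gcongr
    _ = _ := by ring

theorem amp_monomer_cons_mul {lam : ℂ} (R : List Domino) {x : ℤ}
    (hΛ : ∀ y, x ≤ y → y < x + 3 → y ∈ Λ) :
    (amp lam (.monomer :: R) x * pattern x [false, false, false] : Config Λ → ℂ) = 0 := by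
  have h1 : (pattern x [true, false, false] * pattern x [false, false, false] : Config Λ → ℂ) = 0 :=
    pattern_mul_pattern rfl (by simp) hΛ
  have h2 : (pattern x [false, true, true] * pattern x [false, false, false] : Config Λ → ℂ) = 0 :=
    pattern_mul_pattern rfl (by simp) hΛ
  rcases R with _ | ⟨E, R⟩
  · rw [amp, Domino.word, smul_mul_assoc, h1, smul_zero]
  · rw [amp, add_mul, Domino.word, smul_mul_assoc, smul_mul_assoc, mul_right_comm, h1, zero_mul,
      smul_zero, zero_add, smul_mul_assoc, smul_mul_assoc, mul_right_comm,
      mul_right_comm (pattern x _), h2, zero_mul, zero_mul, smul_zero]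

theorem coverLength_replicate_monomer (n : ℕ) :
    coverLength (List.replicate n .monomer) = 3 * n := by
  simp [coverLength, Domino.length, mul_comm]

theorem amp_replicate_mul {lam : ℂ} (n : ℕ) {x : ℤ}
    (hΛ : ∀ y, x ≤ y → y < x + 3 * (n + 1) → y ∈ Λ) :
    (amp lam (List.replicate (n + 1) .monomer) x * pattern (x + 3 * n) [false, true, true] :
      Config Λ → ℂ) = 0 := by
  have h1 : (pattern (x + 3 * n) [true, false, false] * pattern (x + 3 * n) [false, true, true] :
      Config Λ → ℂ) = 0 :=
    pattern_mul_pattern rfl (by simp) fun y h1 h2 => hΛ y (by omega) (by simp at h2; omega)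
  have h2 : (pattern (x + 3 * n) [false, false, false] *
      pattern (x + 3 * n) [false, true, true] : Config Λ → ℂ) = 0 :=
    pattern_mul_pattern rfl (by simp) fun y h1 h2 => hΛ y (by omega) (by simp at h2; omega)
  rcases n with _ | n
  · simpa [amp, Domino.word] using Or.inr h1
  · have h := amp_cut lam .monomer .monomer [] (List.replicate n .monomer) x (Λ := Λ)
    rw [List.replicate_succ', List.replicate_succ', List.append_assoc, List.singleton_append, h,
      coverLength_replicate_monomer]
    simp only [amp, Domino.length, Domino.word, mul_one]
    have e : x + ((3 * n : ℕ) : ℤ) + ((3 : ℕ) : ℤ) = x + 3 * ((n + 1 : ℕ) : ℤ) := by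
      push_cast; ring
    rw [e, add_mul, mul_assoc, mul_assoc, smul_mul_assoc, h1,
      show List.replicate 3 false = [false, false, false] from rfl, h2]
    simp

theorem meanSq_amp_replicate (lam : ℂ) : ∀ (n : ℕ) (x : ℤ),
    (∀ y, x ≤ y → y < x + 3 * n → y ∈ Λ) →
    meanSq (amp lam (List.replicate n .monomer) x : Config Λ → ℂ) =
      chainNormSq (‖lam‖ ^ 2) n / 8 ^ n
  | 0, x, _ => by simp [amp, meanSq_one, chainNormSq]
  | 1, x, h => by
    have hm : meanSq (pattern x Domino.monomer.word : Config Λ → ℂ) = (1 / 2) ^ 3 :=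
      meanSq_pattern fun y h1 h2 => h y h1 (by simpa [Domino.word] using h2)
    simp only [List.replicate_one, amp, Domino.weight, one_smul, hm, chainNormSq]
    norm_num
  | n + 2, x, h => by
    push_cast at h
    have ih1 := meanSq_amp_replicate lam (n + 1) (x + 3) fun y h1 h2 =>
      h y (by omega) (by push_cast at h2; omega)
    have ih2 := meanSq_amp_replicate lam n (x + 6) fun y h1 h2 => h y (by omega) (by omega)
    have hsupp1 := supportedOn_amp lam (List.replicate (n + 1) .monomer) (x + 3) (Λ := Λ)
    have hsupp2 := supportedOn_amp lam (List.replicate n .monomer) (x + 6) (Λ := Λ)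
    have hm1 : meanSq (pattern x [true, false, false] : Config Λ → ℂ) = (1 / 2) ^ 3 :=
      meanSq_pattern fun y h1 h2 => h y h1 (by simp at h2; omega)
    have hm2 : meanSq (pattern x [false, true, true, false, false, false] : Config Λ → ℂ) =
        (1 / 2) ^ 6 :=
      meanSq_pattern fun y h1 h2 => h y h1 (by simp at h2; omega)
    have hs1 := supportedOn_pattern x [true, false, false] (Λ := Λ)
    have hs2 := supportedOn_pattern x [false, true, true, false, false, false] (Λ := Λ)
    have hzero : (pattern x [true, false, false] * pattern x [false, true, true] :
        Config Λ → ℂ) = 0 :=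
      pattern_mul_pattern rfl (by simp) fun y h1 h2 => h y h1 (by simp at h2; omega)
    have happ : (pattern x [false, true, true] * pattern (x + 3) [false, false, false] :
        Config Λ → ℂ) = pattern x [false, true, true, false, false, false] :=
      (pattern_append x [false, true, true] [false, false, false]).symm
    have e : (amp lam (List.replicate (n + 2) .monomer) x : Config Λ → ℂ) =
        pattern x [true, false, false] * amp lam (List.replicate (n + 1) .monomer) (x + 3) +
          lam • (pattern x [false, true, true, false, false, false] *
            amp lam (List.replicate n .monomer) (x + 6)) := by
      rw [List.replicate_succ, List.replicate_succ, amp, ← List.replicate_succ]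
      simp only [Domino.weight, Domino.word, Domino.length, bond, one_smul, Nat.cast_ofNat,
        add_assoc, smul_mul_assoc]
      rw [show List.replicate 3 false = [false, false, false] from rfl, happ]
      norm_num
    rw [e, meanSq_add_of_mul_eq_zero, meanSq_smul, meanSq_mul hs1 hsupp1, meanSq_mul hs2 hsupp2,
      hm1, hm2, ih1, ih2, chainNormSq]
    · field_simp
      ring
    · rw [Set.Ico_disjoint_Ico]
      simp
    · rw [Set.Ico_disjoint_Ico]
      simp
    · rw [mul_smul_comm, ← happ, mul_mul_mul_comm, ← mul_assoc (pattern x _), hzero]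
      simp

open Classical in
/-- The parity `(-1)^N` of the number `N` of particles in `s`. -/
def parity (s : Set ℤ) : Config Λ → ℂ :=
  fun σ => ∏ y : ↥Λ, if (y : ℤ) ∈ s ∧ σ y = true then -1 else 1

theorem supportedOn_parity (s : Set ℤ) : SupportedOn s (parity s : Config Λ → ℂ) := by
  intro σ τ h
  refine Finset.prod_congr rfl fun y _ => ?_
  by_cases hy : (y : ℤ) ∈ s
  · rw [h y hy]
  · simp [hy]

theorem parity_mul_self (s : Set ℤ) : (parity s * parity s : Config Λ → ℂ) = 1 := by
  funext σ
  simp only [Pi.mul_apply, parity, ← Finset.prod_mul_distrib, Pi.one_apply]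
  refine Finset.prod_eq_one fun y _ => ?_
  split_ifs <;> norm_num

theorem star_parity (s : Set ℤ) : star (parity s : Config Λ → ℂ) = parity s := by
  funext σ
  simp only [Pi.star_apply, parity, star_prod]
  refine Finset.prod_congr rfl fun y _ => ?_
  split_ifs <;> simp

theorem parity_union {s t : Set ℤ} (h : Disjoint s t) :
    (parity (s ∪ t) : Config Λ → ℂ) = parity s * parity t := by
  funext σ
  simp only [Pi.mul_apply, parity, ← Finset.prod_mul_distrib]
  refine Finset.prod_congr rfl fun y _ => ?_
  have : (y : ℤ) ∈ s → (y : ℤ) ∉ t := fun hs => Set.disjoint_left.1 h hs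
  by_cases h1 : (y : ℤ) ∈ s <;> by_cases h2 : (y : ℤ) ∈ t <;> simp_all

theorem parity_Ico_mul_parity_Ico {x y z : ℤ} (hxy : x ≤ y) (hyz : y ≤ z) :
    (parity (Set.Ico x y) * parity (Set.Ico y z) : Config Λ → ℂ) = parity (Set.Ico x z) := by
  rw [← Set.Ico_union_Ico_eq_Ico hxy hyz, parity_union]
  rw [Set.disjoint_left]
  intro w h1 h2
  exact absurd h1.2 (not_lt.2 h2.1)

theorem parity_empty : (parity ∅ : Config Λ → ℂ) = 1 := by
  funext σ
  simp [parity]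

theorem parity_eq_neg_one_pow (x : ℤ) (σ : Config Λ) :
    parity (Set.Iio x) σ = (-1 : ℂ) ^ #{y : ↥Λ | (y : ℤ) < x ∧ σ y = true} := by
  simp only [parity, Set.mem_Iio]
  rw [Finset.prod_ite]
  simp

theorem parity_update_of_mem {s : Set ℤ} {x : ℤ} (hx : x ∈ Λ) (hs : x ∈ s) (σ : Config Λ) :
    parity s (Function.update σ ⟨x, hx⟩ (!σ ⟨x, hx⟩)) = -parity s σ := by
  rw [parity, parity, ← Finset.mul_prod_erase univ _ (Finset.mem_univ (⟨x, hx⟩ : ↥Λ))]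
  conv_rhs => rw [← Finset.mul_prod_erase univ _ (Finset.mem_univ (⟨x, hx⟩ : ↥Λ)), ← neg_mul]
  congr 1
  · cases h : σ ⟨x, hx⟩ <;> simp [hs]
  · refine Finset.prod_congr rfl fun y hy => ?_
    rw [Function.update_of_ne (Finset.ne_of_mem_erase hy)]

theorem parity_update_of_notMem {s : Set ℤ} {x : ℤ} (hx : x ∈ Λ) (hs : x ∉ s) (σ : Config Λ)
    (b : Bool) : parity s (Function.update σ ⟨x, hx⟩ b) = parity s σ := by
  refine supportedOn_parity s _ _ fun y hy => Function.update_of_ne ?_ _ _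
  rintro rfl
  exact hs hy

/-! ### Fermionic observables -/

theorem act_opOfMatrix_update (x : ↥Λ) (b : Bool) (M : Config Λ → Config Λ → ℂ) (c : Config Λ → ℂ)
    (hM : ∀ σ τ, M σ τ = if σ x = b ∧ τ = Function.update σ x (!b) then c σ else 0)
    (f : Config Λ → ℂ) (σ : Config Λ) :
    act (opOfMatrix Λ M) f σ = if σ x = b then c σ * f (Function.update σ x (!b)) else 0 := by
  rw [act_opOfMatrix]
  simp only [hM]
  split_ifs with h
  · rw [Finset.sum_eq_single (Function.update σ x (!b))]
    · simp [h]
    · intro τ _ hτ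
      simp [hτ]
    · simp
  · simp [h]

theorem eq_update_iff (x : ↥Λ) (b : Bool) (σ τ : Config Λ) :
    (τ x = !b) ∧ σ = Function.update τ x b ↔ σ x = b ∧ τ = Function.update σ x (!b) := by
  constructor
  · rintro ⟨h, rfl⟩
    simp [← h]
  · rintro ⟨h, rfl⟩
    simp [← h]

theorem annihilation_eq {x : ℤ} (hx : x ∈ Λ) : annihilation Λ x = opOfMatrix Λ fun σ τ =>
    if τ ⟨x, hx⟩ = true ∧ σ = Function.update τ ⟨x, hx⟩ false then parity (Set.Iio x) τ else 0 := by
  rw [annihilation, dif_pos hx]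
  simp only [parity_eq_neg_one_pow]

theorem creation_eq {x : ℤ} (hx : x ∈ Λ) : creation Λ x = opOfMatrix Λ fun σ τ =>
    if σ ⟨x, hx⟩ = true ∧ τ = Function.update σ ⟨x, hx⟩ false then parity (Set.Iio x) σ else 0 := by
  rw [creation, annihilation_eq hx, opOfMatrix, ← ContinuousLinearMap.star_eq_adjoint, ← map_star,
    opOfMatrix]
  congr 1
  ext σ τ
  simp only [Matrix.star_apply, Matrix.of_apply, apply_ite star, star_zero]
  rw [← Pi.star_apply (parity _) σ, star_parity]

/-- The generators of the fermionic observables empty (`b = false`) or fill (`b = true`) a site. -/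
theorem act_fermionGenerator {X : Finset ℤ} (hX : X ⊆ Λ) {A : Op Λ}
    (hA : A ∈ fermionGenerators Λ X) :
    ∃ (x : ℤ) (hx : x ∈ Λ) (b : Bool), x ∈ X ∧ ∀ f σ, act A f σ =
      if σ ⟨x, hx⟩ = b then parity (Set.Iio x) σ * f (Function.update σ ⟨x, hx⟩ (!b)) else 0 := by
  obtain ⟨x, hxX, rfl | rfl⟩ := hA
  · refine ⟨x, hX hxX, false, hxX, fun f σ => ?_⟩
    rw [annihilation_eq (hX hxX)]
    refine act_opOfMatrix_update _ _ _ _ (fun σ τ => ?_) f σ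
    have := eq_update_iff ⟨x, hX hxX⟩ false σ τ
    simp only [Bool.not_false] at this
    simp only [this, Bool.not_false]
    split_ifs with h
    · rw [h.2, parity_update_of_notMem _ (by simp)]
    · rfl
  · refine ⟨x, hX hxX, true, hxX, fun f σ => ?_⟩
    rw [creation_eq (hX hxX)]
    exact act_opOfMatrix_update _ _ _ _ (fun σ τ => rfl) f σ

/-- Multiplication by a function of the configuration. -/
def diagOp (g : Config Λ → ℂ) : Op Λ := opOfMatrix Λ fun σ τ => if σ = τ then g σ else 0

theorem act_diagOp (g f : Config Λ → ℂ) : act (diagOp g) f = g * f := by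
  funext σ
  simp [diagOp, act_opOfMatrix]

theorem act_fermionGenerator_parity_mul {X : Finset ℤ} (hX : X ⊆ Λ) {A : Op Λ}
    (hA : A ∈ fermionGenerators Λ X) {s : Set ℤ} (f : Config Λ → ℂ) :
    ((∀ x ∈ X, x ∈ s) → act A (parity s * f) = -(parity s * act A f)) ∧
      ((∀ x ∈ X, x ∉ s) → act A (parity s * f) = parity s * act A f) := by
  obtain ⟨x, hx, b, hxX, h⟩ := act_fermionGenerator hX hA
  constructor <;> intro hs <;> funext σ
  · have := parity_update_of_mem hx (hs x hxX) σ
    simp only [h, Pi.mul_apply, Pi.neg_apply]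
    split_ifs with hb
    · rw [← hb, this]
      ring
    · ring
  · have := parity_update_of_notMem hx (hs x hxX) σ (!b)
    simp only [h, Pi.mul_apply]
    split_ifs with hb
    · rw [this]
      ring
    · ring

theorem isLocal_diagOp_mul_fermionGenerator {x₁ x₂ : ℤ} (hX : Icc x₁ x₂ ⊆ Λ) {A : Op Λ}
    (hA : A ∈ fermionGenerators Λ (Icc x₁ x₂)) :
    IsLocal (Set.Icc x₁ x₂) (diagOp (parity (Set.Iio x₁)) * A) := by
  obtain ⟨x, hx, b, hxX, h⟩ := act_fermionGenerator hX hA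
  have hx12 := mem_Icc.1 hxX
  have hact : ∀ f σ, act (diagOp (parity (Set.Iio x₁)) * A) f σ =
      if σ ⟨x, hx⟩ = b then
        parity (Set.Ico x₁ x) σ * f (Function.update σ ⟨x, hx⟩ (!b)) else 0 := by
    intro f σ
    have h1 : (parity (Set.Iio x) : Config Λ → ℂ) =
        parity (Set.Iio x₁) * parity (Set.Ico x₁ x) := by
      rw [← parity_union, Set.Iio_union_Ico_eq_Iio hx12.1]
      rw [Set.disjoint_left]
      intro w h1 h2
      exact absurd h2.1 (not_le.2 h1)
    have h2 := congrFun (parity_mul_self (Λ := Λ) (Set.Iio x₁)) σ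
    simp only [Pi.mul_apply, Pi.one_apply] at h2
    rw [act_mul, act_diagOp, Pi.mul_apply, h, h1, mul_ite, mul_zero, Pi.mul_apply, ← mul_assoc,
      ← mul_assoc, h2, one_mul]
  constructor
  · intro f g hg
    funext σ
    have : g (Function.update σ ⟨x, hx⟩ (!b)) = g σ := by
      refine hg _ _ fun y hy => Function.update_of_ne ?_ _ _
      rintro rfl
      exact hy ⟨hx12.1, hx12.2⟩
    simp only [hact, Pi.mul_apply, this, ite_mul, zero_mul, mul_assoc]
  · intro f s hs hf σ τ hστ
    rw [hact, hact, hστ ⟨x, hx⟩ (hs ⟨hx12.1, hx12.2⟩),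
      (supportedOn_parity (Set.Ico x₁ x)).mono (fun y hy => hs ⟨hy.1, hy.2.le.trans hx12.2⟩) σ τ hστ]
    congr 2
    refine hf _ _ fun y hy => ?_
    simp only [Function.update_apply]
    rw [hστ y hy]

theorem isLocal_prod_fermionGenerators {x₁ x₂ : ℤ} (hX : Icc x₁ x₂ ⊆ Λ) (l : List (Op Λ))
    (hl : ∀ c ∈ l, c ∈ fermionGenerators Λ (Icc x₁ x₂)) :
    (Even l.length → IsLocal (Set.Icc x₁ x₂) l.prod) ∧
      (Odd l.length → IsLocal (Set.Icc x₁ x₂) (diagOp (parity (Set.Iio x₁)) * l.prod)) := by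
  induction l with
  | nil => exact ⟨fun _ => isLocal_one, by simp⟩
  | cons c l ih =>
    have ih := ih fun d hd => hl d (List.mem_cons_of_mem c hd)
    have hc := hl c List.mem_cons_self
    have hloc := isLocal_diagOp_mul_fermionGenerator hX hc
    rw [List.prod_cons, List.length_cons]
    constructor
    · intro he
      have := hloc.mul (ih.2 (Nat.not_even_iff_odd.1 (Nat.even_add_one.1 he)))
      convert this using 1
      refine op_ext fun f => ?_
      simp only [act_mul, act_diagOp]
      rw [(act_fermionGenerator_parity_mul hX hc _).2 (by simp +contextual), ← mul_assoc,
        parity_mul_self, one_mul]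
    · intro ho
      rw [← mul_assoc]
      exact hloc.mul (ih.1 (Nat.not_odd_iff_even.1 (Nat.odd_add_one.1 ho)))

theorem isLocal_of_mem_evenObservables {x₁ x₂ : ℤ} (hX : Icc x₁ x₂ ⊆ Λ) {A : Op Λ}
    (hA : A ∈ evenObservables Λ (Icc x₁ x₂)) : IsLocal (Set.Icc x₁ x₂) A := by
  induction hA using Submodule.span_induction with
  | mem A h =>
    obtain ⟨l, hl, he, rfl⟩ := h
    exact (isLocal_prod_fermionGenerators hX l hl).1 he
  | zero => exact isLocal_zero
  | add A B _ _ hA hB => exact hA.add hB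
  | smul c A _ hA => exact hA.smul c

theorem act_oddObservable_parity_mul {X : Finset ℤ} (hX : X ⊆ Λ) {A : Op Λ}
    (hA : A ∈ oddObservables Λ X) {s : Set ℤ} (hs : ∀ x ∈ X, x ∈ s) (f : Config Λ → ℂ) :
    act A (parity s * f) = -(parity s * act A f) := by
  induction hA using Submodule.span_induction with
  | mem A h =>
    obtain ⟨l, hl, ho, rfl⟩ := h
    have key : ∀ l : List (Op Λ), (∀ c ∈ l, c ∈ fermionGenerators Λ X) →
        act l.prod (parity s * f) = (-1 : ℂ) ^ l.length • (parity s * act l.prod f) := by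
      intro l hl
      induction l with
      | nil => simp [act_one]
      | cons c l ih =>
        have hsm : ∀ (k : ℂ) (g : Config Λ → ℂ), act c (k • g) = k • act c g := fun k g => by
          simp [act, WithLp.toLp_smul]
        rw [List.prod_cons, act_mul, act_mul, ih fun d hd => hl d (List.mem_cons_of_mem c hd), hsm,
          (act_fermionGenerator_parity_mul hX (hl c List.mem_cons_self) _).1 hs, List.length_cons,
          pow_succ]
        simp
    rw [key l hl, ho.neg_one_pow, neg_one_smul]
  | zero => simp [act_zero_left]
  | add A B _ _ hA hB => rw [act_add, act_add, hA, hB, mul_add, neg_add]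
  | smul c A _ hA => rw [act_smul, act_smul, hA, smul_neg, mul_smul_comm]

theorem act_fermionAlgebra_parity_mul {X : Finset ℤ} (hX : X ⊆ Λ) {A : Op Λ}
    (hA : A ∈ fermionAlgebra Λ X) {s : Set ℤ} (hs : ∀ x ∈ X, x ∉ s) (f : Config Λ → ℂ) :
    act A (parity s * f) = parity s * act A f := by
  induction hA using Algebra.adjoin_induction generalizing f with
  | mem A h => exact (act_fermionGenerator_parity_mul hX h f).2 hs
  | algebraMap c =>
    rw [Algebra.algebraMap_eq_smul_one, act_smul, act_smul, act_one, act_one, mul_smul_comm]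
  | add A B _ _ hA hB => rw [act_add, act_add, hA, hB, mul_add]
  | mul A B _ _ hA hB => rw [act_mul, act_mul, hB, hA]

/-- An operator that anticommutes with a parity of which `ψ` is an eigenvector has no
expectation in `ψ`. -/
theorem vectorState_eq_zero_of_parity {s : Set ℤ} {ψ : Space Λ} {c : ℂ}
    (hψ : parity s * ψ.ofLp = c • ψ.ofLp) {A : Op Λ}
    (hA : ∀ f, act A (parity s * f) = -(parity s * act A f)) : vectorState ψ A = 0 := by
  have h0 : star ψ.ofLp * act A ψ.ofLp = -(star ψ.ofLp * act A ψ.ofLp) := by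
    have h1 : act A ψ.ofLp = -(parity s * act A (parity s * ψ.ofLp)) := by
      rw [hA, mul_neg, neg_neg, ← mul_assoc, parity_mul_self, one_mul]
    have h2 : star (c • ψ.ofLp) = parity s * star ψ.ofLp := by
      rw [← hψ, star_mul', star_parity]
    have h3 : act A (c • ψ.ofLp) = c • act A ψ.ofLp := by
      simp [act, WithLp.toLp_smul]
    have h4 : star ψ.ofLp = parity s * star (c • ψ.ofLp) := by
      rw [h2, ← mul_assoc, parity_mul_self, one_mul]
    calc star ψ.ofLp * act A ψ.ofLp
        = -(star ψ.ofLp * parity s * act A (parity s * ψ.ofLp)) := by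
          conv_lhs => rw [h1]
          ring
      _ = -(star (c • ψ.ofLp) * (c • act A ψ.ofLp)) := by
          rw [hψ, h3, h2]
          ring
      _ = -((star c * c) • (star ψ.ofLp * act A ψ.ofLp)) := by
          rw [star_smul, smul_mul_smul_comm]
      _ = -(star ψ.ofLp * act A ψ.ofLp) := by
          congr 1
          funext σ
          by_cases hσ : ψ.ofLp σ = 0
          · simp [hσ]
          have h5 := congrFun (show (c * c) • ψ.ofLp = ψ.ofLp by
            rw [mul_smul, ← hψ, ← mul_smul_comm, ← hψ, ← mul_assoc, parity_mul_self, one_mul]) σ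
          have h6 : c * c = 1 := by
            simpa [hσ] using h5
          have h7 : star c * c = 1 := by
            rcases mul_self_eq_one_iff.1 h6 with rfl | rfl <;> simp
          rw [h7, one_smul]
  have h1 : star ψ.ofLp * act A ψ.ofLp = 0 := self_eq_neg.1 h0
  rw [vectorState_eq, h1, mean_zero, zero_div]

/-! ### Raising operators -/

theorem opOfMatrix_single (M : Config Λ → Config Λ → ℂ) (τ σ : Config Λ) :
    (opOfMatrix Λ M (EuclideanSpace.single τ 1)) σ = M σ τ := by
  have := act_opOfMatrix M (EuclideanSpace.single τ (1 : ℂ)).ofLp σ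
  refine this.trans ?_
  simp

theorem isRaising_creation : IsRaising (creation Λ) := by
  intro x hx τ hτ
  ext σ
  rw [creation_eq hx, opOfMatrix_single]
  simp only [PiLp.ofLp_single, Pi.single_apply]
  have h := eq_update_iff ⟨x, hx⟩ true σ τ
  have h0 := hτ ⟨x, hx⟩ le_rfl
  rw [Bool.not_true] at h
  simp only [← h, h0, true_and]
  split_ifs with hσ
  · rw [hσ, parity_update_of_notMem _ (by simp)]
    refine Finset.prod_eq_one fun y _ => ?_
    rw [if_neg]
    rintro ⟨hy, hy'⟩
    rw [hτ y (le_of_lt hy)] at hy'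
    simp at hy'
  · rfl

theorem isRaising_spinRaise : IsRaising (spinRaise Λ) := by
  intro x hx τ hτ
  ext σ
  rw [spinRaise, dif_pos hx, opOfMatrix_single]
  simp [hτ ⟨x, hx⟩ le_rfl]

/-! ### Spin observables -/

/-- The configuration `ρ` on `X`, and `σ` off `X`. -/
def glue {X : Finset ℤ} (σ : Config Λ) (ρ : Config X) : Config Λ :=
  fun y => if h : (y : ℤ) ∈ X then ρ ⟨y, h⟩ else σ y

theorem glue_of_mem {X : Finset ℤ} (σ : Config Λ) (ρ : Config X) (y : ↥Λ) (h : (y : ℤ) ∈ X) :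
    glue σ ρ y = ρ ⟨y, h⟩ := dif_pos h

theorem glue_of_notMem {X : Finset ℤ} (σ : Config Λ) (ρ : Config X) (y : ↥Λ) (h : (y : ℤ) ∉ X) :
    glue σ ρ y = σ y := dif_neg h

theorem restrictConfig_glue {X : Finset ℤ} (h : X ⊆ Λ) (σ : Config Λ) (ρ : Config X) :
    restrictConfig h (glue σ ρ) = ρ := by
  funext x
  exact glue_of_mem σ ρ ⟨x, h x.2⟩ x.2

theorem glue_glue {X : Finset ℤ} (σ : Config Λ) (ρ ρ' : Config X) :
    glue (glue σ ρ) ρ' = glue σ ρ' := by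
  funext y
  by_cases hy : (y : ℤ) ∈ X
  · rw [glue_of_mem _ _ _ hy, glue_of_mem _ _ _ hy]
  · rw [glue_of_notMem _ _ _ hy, glue_of_notMem _ _ _ hy, glue_of_notMem _ _ _ hy]

theorem glue_restrictConfig {X : Finset ℤ} (h : X ⊆ Λ) {σ τ : Config Λ}
    (hστ : ∀ y : ↥Λ, (y : ℤ) ∉ X → σ y = τ y) : glue σ (restrictConfig h τ) = τ := by
  funext y
  by_cases hy : (y : ℤ) ∈ X
  · exact glue_of_mem _ _ _ hy
  · rw [glue_of_notMem _ _ _ hy, hστ y hy]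

theorem act_spinEmbed {X : Finset ℤ} (h : X ⊆ Λ) (A : Op X) (f : Config Λ → ℂ) (σ : Config Λ) :
    act (spinEmbed h A) f σ = act A (fun ρ => f (glue σ ρ)) (restrictConfig h σ) := by
  have hA : ∀ g : Config X → ℂ, act A g = ∑ ρ, g ρ • act A (Pi.single ρ 1) := by
    intro g
    conv_lhs => rw [← Finset.univ_sum_single g]
    rw [act_sum]
    refine Finset.sum_congr rfl fun ρ _ => ?_
    have : Pi.single ρ (g ρ) = g ρ • (Pi.single ρ 1 : Config X → ℂ) := by
      rw [← Pi.single_smul, smul_eq_mul, mul_one]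
    rw [this]
    simp [act, WithLp.toLp_smul]
  have hinner : ∀ ρ ρ' : Config X, inner ℂ (EuclideanSpace.single ρ (1 : ℂ))
      (A (EuclideanSpace.single ρ' 1)) = act A (Pi.single ρ' 1) ρ := by
    intro ρ ρ'
    rw [EuclideanSpace.inner_single_left]
    simp [act]
  rw [spinEmbed, act_opOfMatrix, hA]
  simp only [hinner, ite_mul, zero_mul, Finset.sum_apply, Pi.smul_apply, smul_eq_mul]
  rw [← Finset.sum_filter]
  refine Finset.sum_bij' (fun τ _ => restrictConfig h τ) (fun ρ _ => glue σ ρ) (by simp) ?_ ?_ ?_ ?_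
  · intro ρ _
    simp only [Finset.mem_filter, Finset.mem_univ, true_and]
    intro y hy
    rw [glue_of_notMem _ _ _ hy]
  · intro τ hτ
    exact glue_restrictConfig h (Finset.mem_filter.1 hτ).2
  · intro ρ _
    exact restrictConfig_glue h σ ρ
  · intro τ hτ
    rw [glue_restrictConfig h (Finset.mem_filter.1 hτ).2, mul_comm]

theorem isLocal_spinEmbed {X : Finset ℤ} (h : X ⊆ Λ) (A : Op X) :
    IsLocal (X : Set ℤ) (spinEmbed h A) := by
  constructor
  · intro f g hg
    funext σ
    have : ∀ ρ : Config X, g (glue σ ρ) = g σ := fun ρ =>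
      hg _ _ fun y hy => glue_of_notMem _ _ _ (by simpa using hy)
    rw [Pi.mul_apply, act_spinEmbed, act_spinEmbed]
    have e : (fun ρ : Config X => (f * g) (glue σ ρ)) = g σ • fun ρ => f (glue σ ρ) := by
      funext ρ
      simp [this, mul_comm]
    rw [e]
    simp [act, WithLp.toLp_smul, mul_comm]
  · intro f s hs hf σ τ hστ
    rw [act_spinEmbed, act_spinEmbed]
    have h1 : restrictConfig h σ = restrictConfig h τ := by
      funext x
      exact hστ ⟨x, h x.2⟩ (hs x.2)
    have h2 : (fun ρ : Config X => f (glue σ ρ)) = fun ρ => f (glue τ ρ) := by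
      funext ρ
      refine hf _ _ fun y hy => ?_
      by_cases hX : (y : ℤ) ∈ X
      · rw [glue_of_mem _ _ _ hX, glue_of_mem _ _ _ hX]
      · rw [glue_of_notMem _ _ _ hX, glue_of_notMem _ _ _ hX, hστ y hy]
    rw [h1, h2]

theorem sum_sum_glue {X : Finset ℤ} (h : X ⊆ Λ) (F : Config Λ → ℝ) :
    ∑ σ : Config Λ, ∑ ρ : Config X, F (glue σ ρ) = Fintype.card (Config X) * ∑ σ, F σ := by
  let e : Config Λ × Config X ≃ Config Λ × Config X :=
    { toFun := fun p => (glue p.1 p.2, restrictConfig h p.1)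
      invFun := fun p => (glue p.1 p.2, restrictConfig h p.1)
      left_inv := fun p => by
        simp only [glue_glue, restrictConfig_glue, glue_restrictConfig h fun _ _ => rfl]
      right_inv := fun p => by
        simp only [glue_glue, restrictConfig_glue, glue_restrictConfig h fun _ _ => rfl] }
  calc ∑ σ : Config Λ, ∑ ρ : Config X, F (glue σ ρ)
      = ∑ p : Config Λ × Config X, F (e p).1 := by
        rw [Fintype.sum_prod_type]
        rfl
    _ = ∑ p : Config Λ × Config X, F p.1 := Equiv.sum_comp e fun p => F p.1
    _ = _ := by
      rw [Fintype.sum_prod_type, Finset.mul_sum]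
      refine Finset.sum_congr rfl fun σ _ => ?_
      simp

theorem norm_spinEmbed_le {X : Finset ℤ} (h : X ⊆ Λ) (A : Op X) : ‖spinEmbed h A‖ ≤ ‖A‖ := by
  refine ContinuousLinearMap.opNorm_le_bound _ (norm_nonneg A) fun ψ => ?_
  refine le_of_sq_le_sq ?_ (by positivity)
  have hc : (0 : ℝ) < Fintype.card (Config X) := by exact_mod_cast Fintype.card_pos
  refine le_of_mul_le_mul_left ?_ hc
  rw [mul_pow, EuclideanSpace.norm_sq_eq, EuclideanSpace.norm_sq_eq,
    ← sum_sum_glue h fun σ => ‖(spinEmbed h A ψ) σ‖ ^ 2, mul_left_comm,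
    ← sum_sum_glue h fun σ => ‖ψ σ‖ ^ 2, Finset.mul_sum]
  refine Finset.sum_le_sum fun σ _ => ?_
  have h1 : ∀ ρ : Config X, (spinEmbed h A ψ) (glue σ ρ) =
      A (WithLp.toLp 2 fun ρ => ψ (glue σ ρ)) ρ := by
    intro ρ
    have := act_spinEmbed h A ψ.ofLp (glue σ ρ)
    simp only [glue_glue, restrictConfig_glue] at this
    exact this
  simp only [h1]
  have h2 := A.le_opNorm (WithLp.toLp 2 fun ρ => ψ (glue σ ρ))
  have h3 := pow_le_pow_left₀ (norm_nonneg _) h2 2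
  rwa [mul_pow, EuclideanSpace.norm_sq_eq, EuclideanSpace.norm_sq_eq] at h3

/-! ### Conserved particle numbers -/

/-- `f` is an eigenvector of the parity of the particle number in `[x, y)`. -/
def ParityEigen (x y : ℤ) (c : ℂ) (f : Config Λ → ℂ) : Prop :=
  parity (Set.Ico x y) * f = c • f

theorem ParityEigen.mul {x y z : ℤ} {c d : ℂ} {f g : Config Λ → ℂ} (hf : ParityEigen x y c f)
    (hg : ParityEigen y z d g) (hxy : x ≤ y) (hyz : y ≤ z) : ParityEigen x z (c * d) (f * g) := by
  unfold ParityEigen at *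
  rw [← parity_Ico_mul_parity_Ico hxy hyz, mul_mul_mul_comm, hf, hg, smul_mul_smul_comm]

theorem ParityEigen.mul_right {x y : ℤ} {c : ℂ} {f : Config Λ → ℂ} (hf : ParityEigen x y c f)
    (g : Config Λ → ℂ) : ParityEigen x y c (f * g) := by
  unfold ParityEigen at *
  rw [← mul_assoc, hf, smul_mul_assoc]

theorem ParityEigen.add {x y : ℤ} {c : ℂ} {f g : Config Λ → ℂ} (hf : ParityEigen x y c f)
    (hg : ParityEigen x y c g) : ParityEigen x y c (f + g) := by
  unfold ParityEigen at *
  rw [mul_add, hf, hg, smul_add]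

theorem ParityEigen.smul {x y : ℤ} {c : ℂ} {f : Config Λ → ℂ} (hf : ParityEigen x y c f)
    (k : ℂ) : ParityEigen x y c (k • f) := by
  unfold ParityEigen at *
  rw [mul_smul_comm, hf, smul_comm]

theorem parityEigen_zero {x y : ℤ} {c : ℂ} : ParityEigen x y c (0 : Config Λ → ℂ) := by
  simp [ParityEigen]

/-- The parity of the number of particles of a word. -/
def wordSign (w : List Bool) : ℂ := (w.map fun b => if b then -1 else 1).prod

theorem parityEigen_siteInd {x : ℤ} (hx : x ∈ Λ) (b : Bool) :
    ParityEigen x (x + 1) (if b then -1 else 1) (siteInd x b : Config Λ → ℂ) := by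
  funext σ
  simp only [Pi.mul_apply, Pi.smul_apply, smul_eq_mul]
  by_cases h : ∀ h : x ∈ Λ, σ ⟨x, h⟩ = b
  · rw [siteInd, if_pos h, mul_one, mul_one, parity, Finset.prod_eq_single ⟨x, hx⟩]
    · simp [h hx]
    · intro y _ hy
      rw [if_neg]
      rintro ⟨⟨h1, h2⟩, -⟩
      exact hy (Subtype.ext (by change (y : ℤ) = x; omega))
    · simp
  · rw [siteInd, if_neg h, mul_zero, mul_zero]

theorem parityEigen_pattern {x : ℤ} (w : List Bool)
    (hΛ : ∀ y, x ≤ y → y < x + w.length → y ∈ Λ) :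
    ParityEigen x (x + w.length) (wordSign w) (pattern x w : Config Λ → ℂ) := by
  induction w generalizing x with
  | nil => simp [ParityEigen, wordSign, pattern, parity_empty]
  | cons b w ih =>
    simp only [List.length_cons, Nat.cast_add, Nat.cast_one] at hΛ ⊢
    have := (parityEigen_siteInd (hΛ x le_rfl (by omega)) b).mul
      (ih (x := x + 1) fun y h1 h2 => hΛ y (by omega) (by omega)) (by omega) (by omega)
    rw [show x + 1 + (w.length : ℤ) = x + (w.length + 1) by ring] at this
    simpa [wordSign, pattern] using this

theorem parityEigen_pattern_word {x : ℤ} (D : Domino)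
    (hΛ : ∀ y, x ≤ y → y < x + D.length → y ∈ Λ) :
    ParityEigen x (x + D.length) (wordSign D.word) (pattern x D.word : Config Λ → ℂ) := by
  rw [← D.length_word] at hΛ ⊢
  exact parityEigen_pattern _ hΛ

/-- The parity of the number of particles of a root tiling. -/
def tilingSign (R : List Domino) : ℂ := (R.map fun D => wordSign D.word).prod

theorem parityEigen_amp (lam : ℂ) : ∀ (R : List Domino) (x : ℤ),
    (∀ y, x ≤ y → y < x + coverLength R → y ∈ Λ) →
    ParityEigen x (x + coverLength R) (tilingSign R) (amp lam R x : Config Λ → ℂ)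
  | [], x, _ => by simp [ParityEigen, tilingSign, amp, parity_empty]
  | [D], x, h => by
    simpa [amp, tilingSign] using (parityEigen_pattern_word D (by simpa using h)).smul _
  | D :: E :: R, x, h => by
    simp only [coverLength_cons, Nat.cast_add] at h ⊢
    have h1 := parityEigen_amp lam (E :: R) (x + D.length) fun y h1 h2 =>
      h y (by omega) (by simp only [coverLength_cons, Nat.cast_add] at h2; omega)
    have h2 := parityEigen_amp lam R (x + D.length + E.length) fun y h1 h2 =>
      h y (by omega) (by omega)
    have hD := (parityEigen_pattern_word D (x := x) fun y h1 h2 => h y h1 (by omega)).smul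
      (D.weight lam)
    simp only [coverLength_cons, Nat.cast_add] at h1
    have e : x + D.length + (E.length + coverLength R) =
      x + ((D.length : ℤ) + (E.length + coverLength R)) := by ring
    rw [e] at h1
    rw [amp]
    refine ParityEigen.add ?_ ?_
    · simpa [tilingSign] using hD.mul h1 (by omega) (by omega)
    by_cases hb : D = .monomer ∧ (E = .monomer ∨ E = .rightMonomer1 ∨ E = .rightMonomer2)
    · obtain ⟨rfl, hE⟩ := hb
      have hp := parityEigen_pattern (Λ := Λ) (x := x) [false, true, true] fun y h1 h2 =>
        h y h1 (by simp [Domino.length] at h2 ⊢; omega)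
      have hq := parityEigen_pattern (Λ := Λ) (x := x + Domino.monomer.length)
        (List.replicate E.length false) fun y h1 h2 =>
          h y (by omega) (by simp at h2; omega)
      rw [List.length_replicate] at hq
      have := ((hp.mul hq (by simp) (by
        change x + ((3 : ℕ) : ℤ) ≤ x + ((3 : ℕ) : ℤ) + E.length
        omega)).smul
        (bond lam .monomer E)).mul h2 (by omega) (by omega)
      rw [add_assoc, add_assoc] at this
      convert this using 1
      rcases hE with rfl | rfl | rfl <;>
        simp [tilingSign, wordSign, Domino.word, Domino.length]
    · rw [bond_eq_zero (by tauto), zero_smul, zero_mul]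
      exact parityEigen_zero

theorem parityEigen_amp_monomer (lam : ℂ) (R : List Domino) {x : ℤ}
    (hΛ : ∀ y, x ≤ y → y < x + 2 → y ∈ Λ) :
    ParityEigen x (x + 2) (-1) (amp lam (.monomer :: R) x : Config Λ → ℂ) := by
  have h1 : ParityEigen x (x + 2) (-1) (pattern x [true, false, false] : Config Λ → ℂ) := by
    have := parityEigen_pattern (Λ := Λ) (x := x) [true, false] (by simpa using hΛ)
    rw [show [true, false, false] = [true, false] ++ [false] from rfl, pattern_append]
    refine ParityEigen.mul_right ?_ _
    simpa [wordSign] using this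
  have h2 : ParityEigen x (x + 2) (-1) (pattern x [false, true, true] : Config Λ → ℂ) := by
    have := parityEigen_pattern (Λ := Λ) (x := x) [false, true] (by simpa using hΛ)
    rw [show [false, true, true] = [false, true] ++ [true] from rfl, pattern_append]
    refine ParityEigen.mul_right ?_ _
    simpa [wordSign] using this
  rcases R with _ | ⟨E, R⟩
  · exact h1.smul _
  · exact ((h1.smul _).mul_right _).add (((h2.mul_right _).smul _).mul_right _)

theorem parityEigen_amp_append_void (lam : ℂ) (L R : List Domino) {x : ℤ}
    (hΛ : ∀ y, x ≤ y → y < x + coverLength L → y ∈ Λ) :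
    ParityEigen x (x + coverLength L) (tilingSign L)
      (amp lam (L ++ .void :: R) x : Config Λ → ℂ) := by
  rw [amp_append_void]
  exact (parityEigen_amp lam L x hΛ).mul_right _

theorem parityEigen_amp_append_monomer (lam : ℂ) (L : List Domino) (D : Domino) (R : List Domino)
    {x : ℤ} (hΛ : ∀ y, x ≤ y → y < x + coverLength L + D.length + 2 → y ∈ Λ) :
    ParityEigen x (x + coverLength L + D.length + 2) (-tilingSign (L ++ [D]))
      (amp lam (L ++ D :: .monomer :: R) x : Config Λ → ℂ) := by
  rw [amp_cut]
  refine ParityEigen.add ?_ ?_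
  · have h1 := parityEigen_amp lam (L ++ [D]) x (Λ := Λ) fun y h1 h2 =>
      hΛ y h1 (by simp at h2; omega)
    have h2 := parityEigen_amp_monomer lam R (Λ := Λ) (x := x + coverLength L + D.length)
      fun y h1 h2 => hΛ y (by omega) (by omega)
    simp only [coverLength_append, coverLength_cons, coverLength_nil, add_zero, Nat.cast_add,
      ← add_assoc] at h1
    simpa using h1.mul h2 (by omega) (by omega)
  · by_cases hD : D = .monomer
    · subst hD
      have h1 := parityEigen_amp lam L x (Λ := Λ) fun y h1 h2 => hΛ y h1 (by omega)
      have h2 := parityEigen_pattern (Λ := Λ) (x := x + coverLength L) [false, true, true]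
        fun y h1 h2 => hΛ y (by omega) (by simp [Domino.length] at h2 ⊢; omega)
      have h3 := parityEigen_pattern (Λ := Λ) (x := x + coverLength L + Domino.monomer.length)
        [false, false] fun y h1 h2 => hΛ y (by omega) (by simpa using h2)
      have h4 : (pattern (x + coverLength L + Domino.monomer.length)
          (List.replicate Domino.monomer.length false) : Config Λ → ℂ) =
        pattern (x + coverLength L + Domino.monomer.length) [false, false] *
          pattern (x + coverLength L + Domino.monomer.length + 2) [false] :=
        pattern_append _ [false, false] [false]
      rw [h4]
      have h5 := ((h1.mul h2 (by omega) (by simp)).smul (bond lam .monomer .monomer)).mul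
        ((h3.mul_right (pattern (x + coverLength L + Domino.monomer.length + 2) [false])).mul_right
          (amp lam R (x + coverLength L + Domino.monomer.length + Domino.monomer.length)))
        (by simp; omega) (by simp [Domino.length])
      convert h5 using 1
      · simp
      · simp [tilingSign, wordSign, Domino.word]
    · rw [bond_eq_zero (Or.inl hD), zero_smul, zero_mul]
      exact parityEigen_zero

/-! ### The dominoes between two distant intervals -/

theorem exists_covering_domino (R : List Domino) (p : ℕ) (hp : p < coverLength R) :
    ∃ L D M, R = L ++ D :: M ∧ coverLength L ≤ p ∧ p < coverLength L + D.length := by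
  induction R generalizing p with
  | nil => simp at hp
  | cons D R ih =>
    rw [coverLength_cons] at hp
    by_cases h : p < D.length
    · exact ⟨[], D, R, rfl, by simp, by simpa using h⟩
    · obtain ⟨L, E, M, rfl, h1, h2⟩ := ih (p - D.length) (by omega)
      exact ⟨D :: L, E, M, rfl, by rw [coverLength_cons]; omega, by rw [coverLength_cons]; omega⟩

/-- Voids and monomers, possibly followed by a right boundary domino. -/
def IsRootTail (M : List Domino) : Prop :=
  ∃ m r : List Domino, M = m ++ r ∧ (∀ D ∈ m, D = .void ∨ D = .monomer) ∧
    (r = [] ∨ r = [.rightDimer] ∨ r = [.rightMonomer1] ∨ r = [.rightMonomer2])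

theorem IsRootTail.of_cons {D : Domino} {M : List Domino} (h : IsRootTail (D :: M)) :
    IsRootTail M := by
  obtain ⟨m, r, hM, hm, hr⟩ := h
  rcases m with _ | ⟨E, m⟩
  · rcases hr with rfl | rfl | rfl | rfl <;> simp at hM
    all_goals exact ⟨[], [], by simp [hM.2], by simp, Or.inl rfl⟩
  · obtain ⟨rfl, rfl⟩ := List.cons.inj hM
    exact ⟨m, r, rfl, fun F hF => hm F (List.mem_cons_of_mem _ hF), hr⟩

theorem IsRootTail.of_append {L M : List Domino} (h : IsRootTail (L ++ M)) : IsRootTail M := by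
  induction L with
  | nil => exact h
  | cons D L ih => exact ih (IsRootTail.of_cons h)

theorem IsRootTiling.isRootTail {a b : ℤ} {L M : List Domino} {D : Domino}
    (h : IsRootTiling a b (L ++ D :: M)) : IsRootTail M := by
  obtain ⟨l, m, r, hR, hl, hm, hr, -⟩ := h
  have ht : IsRootTail (m ++ r) := ⟨m, r, rfl, hm, hr⟩
  rcases hl with rfl | rfl
  · rw [List.nil_append] at hR
    rw [← hR] at ht
    exact ht.of_append.of_cons
  · rcases L with _ | ⟨E, L⟩
    · obtain ⟨-, rfl⟩ := List.cons.inj hR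
      exact ht
    · obtain ⟨-, h⟩ := List.cons.inj hR
      change L ++ D :: M = m ++ r at h
      rw [← h] at ht
      exact ht.of_append.of_cons

theorem IsRootTail.monomers_or_void {M : List Domino} (h : IsRootTail M) (n : ℕ)
    (hn : 3 * n < coverLength M) :
    (∃ E S, M = List.replicate n .monomer ++ E :: S) ∨
      ∃ j < n, ∃ S, M = List.replicate j .monomer ++ .void :: S := by
  induction n generalizing M with
  | zero =>
    rcases M with _ | ⟨E, S⟩
    · simp at hn
    · exact Or.inl ⟨E, S, rfl⟩
  | succ n ih =>
    rcases M with _ | ⟨D, M⟩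
    · simp at hn
    have hM := h.of_cons
    obtain ⟨m, r, hmr, hm, hr⟩ := h
    rcases m with _ | ⟨E, m⟩
    · rw [hmr] at hn
      rcases hr with rfl | rfl | rfl | rfl <;> (simp [Domino.length] at hn; try omega)
    obtain ⟨rfl, -⟩ := List.cons.inj hmr
    rcases hm D List.mem_cons_self with rfl | rfl
    · exact Or.inr ⟨0, by omega, M, rfl⟩
    · rw [coverLength_cons, show Domino.monomer.length = 3 from rfl] at hn
      rcases ih hM (by omega) with ⟨E, S, rfl⟩ | ⟨j, hj, S, rfl⟩
      · exact Or.inl ⟨E, S, by simp [List.replicate_succ]⟩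
      · exact Or.inr ⟨j + 1, by omega, S, by simp [List.replicate_succ]⟩

theorem IsRootTiling.coverLength_eq {a b : ℤ} {R : List Domino} (h : IsRootTiling a b R) :
    coverLength R = #(Icc a b) := by
  obtain ⟨l, m, r, -, -, -, -, h⟩ := h
  exact h

/-- The sites between `p` and `q` either contain `n` adjacent monomers of the root tiling, or a
void after which the root tiling can be cut. -/
theorem IsRootTiling.exists_gap {a b p q : ℤ} {R : List Domino} (h : IsRootTiling a b R)
    (hp : a ≤ p) (hq : q ≤ b) (n : ℕ) (hn : p + 6 + 3 * n ≤ q) :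
    (∃ L D E S, R = L ++ D :: (List.replicate n .monomer ++ E :: S) ∧
        p < a + coverLength L + D.length ∧ a + coverLength L + D.length + 3 * n ≤ q) ∨
      ∃ L S, R = L ++ .void :: S ∧ p < a + coverLength L ∧ a + coverLength L ≤ q := by
  have hlen := h.coverLength_eq
  rw [Int.card_Icc] at hlen
  obtain ⟨L, D, M, rfl, h1, h2⟩ := exists_covering_domino R (p - a).toNat (by omega)
  have hD : D.length ≤ 6 := by cases D <;> simp [Domino.length]
  simp only [coverLength_append, coverLength_cons] at hlen
  rcases h.isRootTail.monomers_or_void n (by omega) with ⟨E, S, rfl⟩ | ⟨j, hj, S, rfl⟩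
  · exact Or.inl ⟨L, D, E, S, rfl, by omega, by omega⟩
  · refine Or.inr ⟨L ++ D :: List.replicate j .monomer, S, by simp, ?_, ?_⟩ <;>
    · simp only [coverLength_append, coverLength_cons, coverLength_replicate_monomer]
      omega

/-! ### Clustering across a gap -/

theorem norm_covariance_le_of_void {a b : ℤ} {X Y : Set ℤ} {A B : Op (Icc a b)}
    (hA : IsLocal X A) (hB : IsLocal Y B) {lam : ℂ} {L S : List Domino}
    (hX : X ⊆ Set.Iio (a + coverLength L)) (hY : Y ⊆ Set.Ici (a + coverLength L))
    {ψ : Space (Icc a b)} (hψ : ψ.ofLp = amp lam (L ++ .void :: S) a) {κ : ℝ} (hκ : 0 ≤ κ) :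
    ‖vectorState ψ (A * B) - vectorState ψ A * vectorState ψ B‖ ≤ κ * ‖A‖ * ‖B‖ ∧
      vectorState ψ (A * B) = vectorState ψ (B * A) := by
  refine norm_covariance_le (l := Set.Iio (a + coverLength L)) (m := ∅)
    (r := Set.Ici (a + coverLength L)) hA hB hX hY (by simp) ?_ (by simp)
    (φ := ![amp lam L a, 0]) (ξ := ![![1, 0], ![0, 0]])
    (χ := ![amp lam (.void :: S) (a + coverLength L), 0]) ?_ ?_ ?_ ?_ ?_ hκ ?_
  · refine Set.disjoint_left.2 fun y h1 h2 => ?_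
    rw [Set.mem_Iio] at h1
    rw [Set.mem_Ici] at h2
    omega
  · rw [Fin.forall_fin_two]
    exact ⟨(supportedOn_amp lam L a).mono fun y hy => hy.2, supportedOn_zero⟩
  · simp only [Fin.forall_fin_two]
    exact ⟨⟨supportedOn_one, supportedOn_zero⟩, supportedOn_zero, supportedOn_zero⟩
  · rw [Fin.forall_fin_two]
    exact ⟨(supportedOn_amp lam _ _).mono fun y hy => hy.1, supportedOn_zero⟩
  · simp [Fin.forall_fin_two]
  · simp [hψ, amp_append_void]
  · simp [meanSq_zero]

theorem amp_replicate_append (lam : ℂ) (n : ℕ) (E : Domino) (S : List Domino) (x : ℤ) :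
    (amp lam (List.replicate (n + 1) .monomer ++ E :: S) x : Config Λ → ℂ) =
      amp lam (List.replicate (n + 1) .monomer) x * amp lam (E :: S) (x + 3 * (n + 1)) +
        (amp lam (List.replicate n .monomer) x * pattern (x + 3 * n) [false, true, true]) *
          (bond lam .monomer E • (pattern (x + 3 * (n + 1)) (List.replicate E.length false) *
            amp lam S (x + 3 * (n + 1) + E.length))) := by
  have h := amp_cut lam .monomer E S (List.replicate n .monomer) x (Λ := Λ)
  have e : x + ((3 * n : ℕ) : ℤ) + ((3 : ℕ) : ℤ) = x + 3 * ((n : ℤ) + 1) := by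
    push_cast
    ring
  rw [coverLength_replicate_monomer, show Domino.monomer.length = 3 from rfl, e,
    ← List.replicate_succ'] at h
  rw [List.replicate_succ', List.append_assoc, List.singleton_append, ← List.replicate_succ', h]
  push_cast
  rw [smul_mul_assoc, mul_smul_comm]

theorem norm_covariance_le_of_monomers {a b : ℤ} {X Y : Set ℤ} {A B : Op (Icc a b)}
    (hA : IsLocal X A) (hB : IsLocal Y B) {lam : ℂ} {L S : List Domino} {D E : Domino} {n : ℕ}
    (hX : X ⊆ Set.Iio (a + coverLength L + D.length))
    (hY : Y ⊆ Set.Ici (a + coverLength L + D.length + 3 * (n + 2)))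
    (hb : a + coverLength L + D.length + 3 * (n + 2) ≤ b + 1)
    {ψ : Space (Icc a b)}
    (hψ : ψ.ofLp = amp lam (L ++ D :: (List.replicate (n + 2) .monomer ++ E :: S)) a) {κ : ℝ}
    (hκ : 0 ≤ κ)
    (hdet : (‖lam‖ ^ 2) ^ (n + 1) ≤ κ * chainNormSq (‖lam‖ ^ 2) (n + 1) ^ 2) :
    ‖vectorState ψ (A * B) - vectorState ψ A * vectorState ψ B‖ ≤ κ * ‖A‖ * ‖B‖ ∧
      vectorState ψ (A * B) = vectorState ψ (B * A) := by
  set s : ℤ := a + coverLength L + D.length with hs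
  set t : ℤ := s + 3 * (n + 2) with ht
  have hΛ : ∀ y, s ≤ y → y < t → y ∈ Icc a b := fun y h1 h2 => mem_Icc.2 ⟨by omega, by omega⟩
  have e1 : s + 3 + 3 * ((n : ℤ) + 1) = t := by rw [ht]; ring
  have e2 : s + 3 * (((n + 1 : ℕ) : ℤ) + 1) = t := by rw [ht]; push_cast; ring
  have e3 : s + 3 + 3 * (n : ℤ) = s + 3 * ((n : ℤ) + 1) := by ring
  have e4 : s + 3 * (n : ℤ) + 3 = s + 3 * ((n : ℤ) + 1) := by ring
  set w : ℤ := s + 3 * ((n : ℤ) + 1) with hw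
  set φ₁ : Config (Icc a b) → ℂ :=
    bond lam D .monomer • (amp lam L a * pattern (a + coverLength L) [false, true, true]) with hφ₁
  set χ₁ : Config (Icc a b) → ℂ := bond lam .monomer E •
    (pattern t (List.replicate E.length false) * amp lam S (t + E.length)) with hχ₁
  set z : Config (Icc a b) → ℂ := pattern s [false, false, false] with hz
  set o : Config (Icc a b) → ℂ := pattern w [false, true, true] with ho
  set m₀ : Config (Icc a b) → ℂ := amp lam (List.replicate n .monomer) (s + 3) with hm₀
  set m₁ : Config (Icc a b) → ℂ := amp lam (List.replicate (n + 1) .monomer) s with hm₁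
  set m₁' : Config (Icc a b) → ℂ := amp lam (List.replicate (n + 1) .monomer) (s + 3) with hm₁'
  set m₂ : Config (Icc a b) → ℂ := amp lam (List.replicate (n + 2) .monomer) s with hm₂
  have hψ' : ψ.ofLp = amp lam (L ++ [D]) a * (m₂ * amp lam (E :: S) t + m₁ * o * χ₁) +
      φ₁ * (z * (m₁' * amp lam (E :: S) t + m₀ * o * χ₁)) := by
    have h1 := amp_replicate_append lam (n + 1) E S s (Λ := Icc a b)
    have h2 := amp_replicate_append lam n E S (s + 3) (Λ := Icc a b)
    have h3 := amp_cut lam D .monomer (List.replicate (n + 1) .monomer ++ E :: S) L a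
      (Λ := Icc a b)
    rw [e2] at h1
    rw [e1, e3] at h2
    rw [← hs, show Domino.monomer.length = 3 from rfl, Nat.cast_ofNat, h2,
      ← List.cons_append, ← List.replicate_succ, h1] at h3
    push_cast at h3
    exact hψ.trans h3
  have sL : SupportedOn (Set.Iio s) (amp lam (L ++ [D]) a : Config (Icc a b) → ℂ) := by
    refine (supportedOn_amp lam (L ++ [D]) a).mono fun y hy => ?_
    have := hy.2
    simp only [coverLength_append, coverLength_cons, coverLength_nil, Nat.cast_add] at this
    exact lt_of_lt_of_le this (by omega)
  have sφ₁ : SupportedOn (Set.Iio s) φ₁ := by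
    by_cases hD : D = .monomer
    · have hD3 : D.length = 3 := by rw [hD]; rfl
      refine (((supportedOn_amp lam L a).mono fun y hy => ?_).mul
        ((supportedOn_pattern _ _).mono fun y hy => ?_)).smul _
      · have := hy.2
        exact Set.mem_Iio.2 (by omega)
      · have := hy.2
        simp only [List.length_cons, List.length_nil] at this
        exact Set.mem_Iio.2 (by omega)
    · rw [hφ₁, bond_eq_zero (Or.inl hD), zero_smul]
      exact supportedOn_zero
  have sχ₁ : SupportedOn (Set.Ici t) χ₁ := by
    refine (((supportedOn_pattern _ _).mono fun y hy => hy.1).mul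
      ((supportedOn_amp lam S _).mono fun y hy => ?_)).smul _
    have := hy.1
    exact Set.mem_Ici.2 (by omega)
  have sz := supportedOn_pattern s [false, false, false] (Λ := Icc a b)
  have so := supportedOn_pattern w [false, true, true] (Λ := Icc a b)
  have sm₀ := supportedOn_amp lam (List.replicate n .monomer) (s + 3) (Λ := Icc a b)
  have sm₁ := supportedOn_amp lam (List.replicate (n + 1) .monomer) s (Λ := Icc a b)
  have sm₁' := supportedOn_amp lam (List.replicate (n + 1) .monomer) (s + 3) (Λ := Icc a b)
  have sm₂ := supportedOn_amp lam (List.replicate (n + 2) .monomer) s (Λ := Icc a b)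
  simp only [List.length_cons, List.length_nil, coverLength_replicate_monomer] at sz so sm₀ sm₁ sm₁' sm₂
  push_cast at sz so sm₀ sm₁ sm₁' sm₂
  rw [e3] at sm₀
  rw [e1] at sm₁'
  have ewt : w + 3 = t := by rw [hw, ht]; ring
  rw [ewt] at so
  have hsw : s + 3 ≤ w := by omega
  have hΛz : ∀ y, s ≤ y → y < s + 3 → y ∈ Icc a b := fun y h1 h2 => hΛ y h1 (by omega)
  have hΛo : ∀ y, w ≤ y → y < w + ([false, true, true].length : ℕ) → y ∈ Icc a b := fun y h1 h2 =>
    hΛ y (by omega) (by simp at h2; omega)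
  have z₂ : m₂ * z = 0 := amp_monomer_cons_mul _ hΛz
  have z₁ : m₁ * z = 0 := amp_monomer_cons_mul _ hΛz
  have o₂ : m₂ * o = 0 := by
    have := amp_replicate_mul (lam := lam) (n + 1) (x := s) (Λ := Icc a b) fun y h1 h2 =>
      hΛ y h1 (by push_cast at h2; omega)
    push_cast at this
    exact this
  have o₁ : m₁' * o = 0 := by
    have := amp_replicate_mul (lam := lam) n (x := s + 3) (Λ := Icc a b) fun y h1 h2 =>
      hΛ y (by omega) (by omega)
    rwa [e3] at this
  have qz : meanSq z = 1 / 8 := by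
    rw [hz, meanSq_pattern fun y h1 h2 => hΛz y h1 (by simpa using h2)]
    norm_num
  have qo : meanSq o = 1 / 8 := by
    rw [ho, meanSq_pattern hΛo]
    norm_num
  have q₀ := meanSq_amp_replicate lam n (s + 3) (Λ := Icc a b) fun y h1 h2 =>
    hΛ y (by omega) (by omega)
  have q₁ := meanSq_amp_replicate lam (n + 1) s (Λ := Icc a b) fun y h1 h2 =>
    hΛ y h1 (by push_cast at h2; omega)
  have q₁' := meanSq_amp_replicate lam (n + 1) (s + 3) (Λ := Icc a b) fun y h1 h2 =>
    hΛ y (by omega) (by push_cast at h2; omega)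
  have q₂ := meanSq_amp_replicate lam (n + 2) s (Λ := Icc a b) fun y h1 h2 =>
    hΛ y h1 (by push_cast at h2; omega)
  rw [← hm₀] at q₀
  rw [← hm₁] at q₁
  rw [← hm₁'] at q₁'
  rw [← hm₂] at q₂
  have dIco : ∀ p q r : ℤ, p ≤ q → Disjoint (Set.Ico p q) (Set.Ico q r) := fun p q r _ =>
    Set.disjoint_left.2 fun y h1 h2 => absurd h1.2 (not_lt.2 h2.1)
  have q01 : meanSq (m₁ * o) = chainNormSq (‖lam‖ ^ 2) (n + 1) / 8 ^ (n + 1) * (1 / 8) := by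
    rw [meanSq_mul sm₁ so (dIco _ _ _ (by omega)), q₁, qo]
  have q10 : meanSq (z * m₁') = 1 / 8 * (chainNormSq (‖lam‖ ^ 2) (n + 1) / 8 ^ (n + 1)) := by
    rw [meanSq_mul sz sm₁' (dIco _ _ _ (by omega)), q₁', qz]
  have smo : SupportedOn (Set.Ico (s + 3) t) (m₀ * o) :=
    (sm₀.mono (Set.Ico_subset_Ico_right (by omega))).mul (so.mono (Set.Ico_subset_Ico_left hsw))
  have q11 : meanSq (z * (m₀ * o)) =
      1 / 8 * (chainNormSq (‖lam‖ ^ 2) n / 8 ^ n * (1 / 8)) := by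
    rw [meanSq_mul sz smo (dIco _ _ _ (by omega)),
      meanSq_mul sm₀ so (dIco _ _ _ (by omega)), q₀, qz, qo]
  refine norm_covariance_le (l := Set.Iio s) (m := Set.Ico s t) (r := Set.Ici t) hA hB hX hY
    ?_ ?_ ?_ (φ := ![amp lam (L ++ [D]) a, φ₁])
    (ξ := ![![m₂, m₁ * o], ![z * m₁', z * (m₀ * o)]])
    (χ := ![amp lam (E :: S) t, χ₁]) ?_ ?_ ?_ ?_ ?_ hκ ?_
  · exact Set.disjoint_left.2 fun y h1 h2 => absurd h1 (not_lt.2 h2.1)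
  · refine Set.disjoint_left.2 fun y h1 h2 => ?_
    rw [Set.mem_Iio] at h1
    rw [Set.mem_Ici] at h2
    omega
  · exact Set.disjoint_left.2 fun y h1 h2 => absurd h1.2 (not_lt.2 h2)
  · rw [Fin.forall_fin_two]
    exact ⟨sL, sφ₁⟩
  · simp only [Fin.forall_fin_two]
    refine ⟨⟨sm₂.mono ?_, (sm₁.mono ?_).mul (so.mono ?_)⟩, (sz.mono ?_).mul (sm₁'.mono ?_),
      (sz.mono ?_).mul (smo.mono ?_)⟩ <;> exact Set.Ico_subset_Ico (by omega) (by omega)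
  · rw [Fin.forall_fin_two]
    exact ⟨(supportedOn_amp lam _ _).mono fun y hy => hy.1, sχ₁⟩
  · have h01 : m₂ * (m₁ * o) = 0 := by rw [mul_left_comm, o₂, mul_zero]
    have h02 : m₂ * (z * m₁') = 0 := by rw [← mul_assoc, z₂, zero_mul]
    have h03 : m₂ * (z * (m₀ * o)) = 0 := by rw [← mul_assoc, z₂, zero_mul]
    have h12 : m₁ * o * (z * m₁') = 0 := by
      rw [mul_mul_mul_comm, z₁, zero_mul]
    have h13 : m₁ * o * (z * (m₀ * o)) = 0 := by
      rw [mul_mul_mul_comm, z₁, zero_mul]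
    have h23 : z * m₁' * (z * (m₀ * o)) = 0 := by
      rw [mul_mul_mul_comm, mul_left_comm m₁', o₁, mul_zero, mul_zero]
    simp only [Fin.forall_fin_two]
    simp [h01, h02, h03, h12, h13, h23, mul_comm (m₁ * o) m₂, mul_comm (z * m₁') m₂,
      mul_comm (z * (m₀ * o)) m₂, mul_comm (z * m₁') (m₁ * o), mul_comm (z * (m₀ * o)) (m₁ * o),
      mul_comm (z * (m₀ * o)) (z * m₁')]
  · rw [hψ']
    simp only [Fin.sum_univ_two, Matrix.cons_val_zero, Matrix.cons_val_one]
    ring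
  · simp only [Matrix.cons_val_zero, Matrix.cons_val_one]
    rw [q₂, q01, q10, q11]
    have hd := chainNormSq_det (‖lam‖ ^ 2) n
    have e : chainNormSq (‖lam‖ ^ 2) (n + 2) / 8 ^ (n + 2) *
        (1 / 8 * (chainNormSq (‖lam‖ ^ 2) n / 8 ^ n * (1 / 8))) -
        chainNormSq (‖lam‖ ^ 2) (n + 1) / 8 ^ (n + 1) * (1 / 8) *
          (1 / 8 * (chainNormSq (‖lam‖ ^ 2) (n + 1) / 8 ^ (n + 1))) =
        (-1) ^ n * (‖lam‖ ^ 2) ^ (n + 1) / (8 ^ (n + 2)) ^ 2 := by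
      rw [← hd]
      field_simp
      ring
    rw [e, abs_div, abs_mul, abs_pow, abs_neg, abs_one, one_pow, one_mul,
      abs_of_nonneg (by positivity : (0 : ℝ) ≤ (‖lam‖ ^ 2) ^ (n + 1)),
      abs_of_nonneg (by positivity : (0 : ℝ) ≤ (8 ^ (n + 2)) ^ 2), div_le_iff₀ (by positivity)]
    refine hdet.trans (le_of_eq ?_)
    field_simp
    ring

theorem four_mul_pow_le_exp {lam : ℂ} (hlam : lam ≠ 0) {k d : ℕ} (hd : (d : ℝ) - 20 ≤ 12 * k) :
    4 * ((√(4 * ‖lam‖ ^ 2 + 1) - 1) / (√(4 * ‖lam‖ ^ 2 + 1) + 1)) ^ (2 * k) ≤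
      8 * Real.exp (-(decayRate lam) * ((d : ℝ) - 20) / 2) := by
  have hpos : 0 < ‖lam‖ ^ 2 := by positivity
  unfold decayRate
  set s := √(4 * ‖lam‖ ^ 2 + 1)
  have hs : 1 < s := Real.lt_sqrt_of_sq_lt (by linarith)
  have hq : 0 < (s + 1) / (s - 1) := div_pos (by linarith) (by linarith)
  have hlog : 0 ≤ Real.log ((s + 1) / (s - 1)) :=
    Real.log_nonneg ((one_le_div (by linarith)).2 (by linarith))
  have e : ((s - 1) / (s + 1)) ^ (2 * k) =
      Real.exp (-(2 * k) * Real.log ((s + 1) / (s - 1))) := by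
    rw [← inv_div, ← Real.exp_log hq, Real.log_exp, ← Real.exp_neg, ← Real.exp_nat_mul]
    congr 1
    push_cast
    ring
  have hle : Real.exp (-(2 * k) * Real.log ((s + 1) / (s - 1))) ≤
      Real.exp (-(1 / 3 * Real.log ((s + 1) / (s - 1))) * ((d : ℝ) - 20) / 2) := by
    rw [Real.exp_le_exp]
    nlinarith
  rw [e]
  linarith [Real.exp_pos (-(1 / 3 * Real.log ((s + 1) / (s - 1))) * ((d : ℝ) - 20) / 2)]

theorem siteDist_le {x₁ x₂ y₁ y₂ : ℤ} (h : 20 ≤ siteDist (Icc x₁ x₂) (Icc y₁ y₂)) :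
    x₁ ≤ x₂ ∧ y₁ ≤ y₂ ∧
      (x₂ + siteDist (Icc x₁ x₂) (Icc y₁ y₂) ≤ y₁ ∨ y₂ + siteDist (Icc x₁ x₂) (Icc y₁ y₂) ≤ x₁) := by
  have hle : ∀ x y, x₁ ≤ x → x ≤ x₂ → y₁ ≤ y → y ≤ y₂ →
      siteDist (Icc x₁ x₂) (Icc y₁ y₂) ≤ (x - y).natAbs := fun x y h1 h2 h3 h4 =>
    Nat.sInf_le ⟨x, mem_Icc.2 ⟨h1, h2⟩, y, mem_Icc.2 ⟨h3, h4⟩, rfl⟩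
  have hne : {d | ∃ x ∈ Icc x₁ x₂, ∃ y ∈ Icc y₁ y₂, d = (x - y).natAbs}.Nonempty := by
    by_contra hne
    rw [Set.not_nonempty_iff_eq_empty] at hne
    rw [siteDist, hne, Nat.sInf_empty] at h
    omega
  obtain ⟨d, x, hx, y, hy, -⟩ := hne
  rw [mem_Icc] at hx hy
  refine ⟨hx.1.trans hx.2, hy.1.trans hy.2, ?_⟩
  have h1 := hle x₂ y₁ (hx.1.trans hx.2) le_rfl le_rfl (hy.1.trans hy.2)
  have h2 := hle x₁ y₂ le_rfl (hx.1.trans hx.2) (hy.1.trans hy.2) le_rfl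
  have h3 := hle (max x₁ y₁) (max x₁ y₁)
  omega

section Clustering

variable {lam : ℂ} {a b : ℤ} {R : List Domino}

/-- Clustering for local operators, the first to the left of the second. -/
theorem norm_covariance_le_of_lt (hlam : lam ≠ 0) (hR : IsRootTiling a b R) {ψ : Space (Icc a b)}
    (hψ : ψ.ofLp = amp lam R a) {x₁ x₂ y₁ y₂ : ℤ} (hx : a ≤ x₂) (hy : y₁ ≤ b) {d : ℕ}
    (hd : 20 ≤ d) (hxy : x₂ + d ≤ y₁) {A B : Op (Icc a b)} (hA : IsLocal (Set.Icc x₁ x₂) A)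
    (hB : IsLocal (Set.Icc y₁ y₂) B) :
    ‖vectorState ψ (A * B) - vectorState ψ A * vectorState ψ B‖ ≤
        8 * ‖A‖ * ‖B‖ * Real.exp (-(decayRate lam) * ((d : ℝ) - 20) / 2) ∧
      vectorState ψ (A * B) = vectorState ψ (B * A) := by
  obtain ⟨k, hk⟩ : ∃ k : ℕ, k + 1 = (d - 9) / 6 := ⟨(d - 9) / 6 - 1, by omega⟩
  have hκ := four_mul_pow_le_exp hlam (k := k + 1) (d := d) (by
    have : (d : ℝ) ≤ 12 * ((k + 1 : ℕ) : ℝ) + 20 := by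
      exact_mod_cast (by omega : d ≤ 12 * (k + 1) + 20)
    linarith)
  set κ := 8 * Real.exp (-(decayRate lam) * ((d : ℝ) - 20) / 2) with hκ'
  have hκ0 : 0 ≤ κ := by positivity
  have e : 8 * ‖A‖ * ‖B‖ * Real.exp (-(decayRate lam) * ((d : ℝ) - 20) / 2) =
      κ * ‖A‖ * ‖B‖ := by
    rw [hκ']
    ring
  rw [e]
  rcases hR.exists_gap hx hy (2 * k + 1 + 2) (by push_cast; omega) with
    ⟨L, D, E, S, rfl, h1, h2⟩ | ⟨L, S, rfl, h1, h2⟩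
  · push_cast at h2
    refine norm_covariance_le_of_monomers (n := 2 * k + 1) hA hB (fun y hy => ?_) (fun y hy => ?_)
      ?_ hψ hκ0 ?_
    · exact Set.mem_Iio.2 (lt_of_le_of_lt hy.2 h1)
    · refine Set.mem_Ici.2 (le_trans ?_ hy.1)
      push_cast
      exact h2
    · push_cast
      omega
    · refine (pow_le_chainNormSq_sq (sq_nonneg ‖lam‖) (k + 1)).trans ?_
      exact mul_le_mul_of_nonneg_right hκ (sq_nonneg _)
  · exact norm_covariance_le_of_void hA hB (fun y hy => Set.mem_Iio.2 (lt_of_le_of_lt hy.2 h1))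
      (fun y hy => Set.mem_Ici.2 (h2.trans hy.1)) hψ hκ0

theorem norm_covariance_le_of_siteDist (hlam : lam ≠ 0) (hR : IsRootTiling a b R)
    {ψ : Space (Icc a b)} (hψ : ψ.ofLp = amp lam R a) {x₁ x₂ y₁ y₂ : ℤ}
    (hX : Icc x₁ x₂ ⊆ Icc a b) (hY : Icc y₁ y₂ ⊆ Icc a b)
    (hdist : 20 ≤ siteDist (Icc x₁ x₂) (Icc y₁ y₂)) {A B : Op (Icc a b)}
    (hA : IsLocal (Set.Icc x₁ x₂) A) (hB : IsLocal (Set.Icc y₁ y₂) B) :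
    ‖vectorState ψ (A * B) - vectorState ψ A * vectorState ψ B‖ ≤ 8 * ‖A‖ * ‖B‖ *
      Real.exp (-(decayRate lam) * ((siteDist (Icc x₁ x₂) (Icc y₁ y₂) : ℝ) - 20) / 2) := by
  obtain ⟨hx, hy, hlt⟩ := siteDist_le hdist
  have hx1 := mem_Icc.1 (hX (mem_Icc.2 ⟨le_rfl, hx⟩))
  have hx2 := mem_Icc.1 (hX (mem_Icc.2 ⟨hx, le_rfl⟩))
  have hy1 := mem_Icc.1 (hY (mem_Icc.2 ⟨le_rfl, hy⟩))
  have hy2 := mem_Icc.1 (hY (mem_Icc.2 ⟨hy, le_rfl⟩))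
  rcases hlt with hlt | hlt
  · exact (norm_covariance_le_of_lt hlam hR hψ hx2.1 hy1.2 hdist hlt hA hB).1
  · have h := norm_covariance_le_of_lt hlam hR hψ hy2.1 hx1.2 hdist hlt hB hA
    rw [← h.2, mul_comm (vectorState ψ A)]
    refine h.1.trans (le_of_eq ?_)
    ring

/-- The particle numbers to the left and to the right of some site in every gap are conserved. -/
theorem exists_parityEigen (hR : IsRootTiling a b R) {p q : ℤ} (hp : a ≤ p) (hq : q ≤ b)
    (hpq : p + 9 ≤ q) :
    ∃ u c, p < u ∧ u ≤ q ∧ ParityEigen a u c (amp lam R a : Config (Icc a b) → ℂ) := by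
  rcases hR.exists_gap hp hq 1 (by push_cast; omega) with
    ⟨L, D, E, S, rfl, h1, h2⟩ | ⟨L, S, rfl, h1, h2⟩
  · push_cast at h2
    exact ⟨_, _, by omega, by omega, parityEigen_amp_append_monomer lam L D (E :: S) fun y h3 h4 =>
      mem_Icc.2 ⟨h3, by omega⟩⟩
  · exact ⟨_, _, h1, h2, parityEigen_amp_append_void lam L S fun y h3 h4 =>
      mem_Icc.2 ⟨h3, by omega⟩⟩

theorem ParityEigen.compl {Λ : Finset ℤ} {x y z : ℤ} {c d : ℂ} {f : Config Λ → ℂ}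
    (hf : ParityEigen x y c f) (hg : ParityEigen x z d f) (hxy : x ≤ y) (hyz : y ≤ z) :
    ParityEigen y z (c * d) f := by
  unfold ParityEigen at *
  rw [← parity_Ico_mul_parity_Ico hxy hyz] at hg
  calc parity (Set.Ico y z) * f
      = parity (Set.Ico x y) * (parity (Set.Ico x y) * parity (Set.Ico y z) * f) := by
        rw [← mul_assoc, ← mul_assoc, parity_mul_self, one_mul]
    _ = _ := by rw [hg, mul_smul_comm, hf, smul_smul, mul_comm]

theorem vectorState_odd_mul_eq_zero (hR : IsRootTiling a b R) {ψ : Space (Icc a b)}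
    (hψ : ψ.ofLp = amp lam R a) {x₁ x₂ y₁ y₂ : ℤ} (hX : Icc x₁ x₂ ⊆ Icc a b)
    (hY : Icc y₁ y₂ ⊆ Icc a b) (hdist : 20 ≤ siteDist (Icc x₁ x₂) (Icc y₁ y₂))
    {A B : Op (Icc a b)} (hA : A ∈ oddObservables (Icc a b) (Icc x₁ x₂))
    (hB : B ∈ fermionAlgebra (Icc a b) (Icc y₁ y₂)) : vectorState ψ (A * B) = 0 := by
  obtain ⟨hx, hy, hlt⟩ := siteDist_le hdist
  have hx1 := mem_Icc.1 (hX (mem_Icc.2 ⟨le_rfl, hx⟩))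
  have hx2 := mem_Icc.1 (hX (mem_Icc.2 ⟨hx, le_rfl⟩))
  have hy1 := mem_Icc.1 (hY (mem_Icc.2 ⟨le_rfl, hy⟩))
  have hy2 := mem_Icc.1 (hY (mem_Icc.2 ⟨hy, le_rfl⟩))
  have key : ∀ (u v : ℤ) (c : ℂ), ParityEigen u v c ψ.ofLp →
      (∀ x ∈ Icc x₁ x₂, x ∈ Set.Ico u v) → (∀ y ∈ Icc y₁ y₂, y ∉ Set.Ico u v) →
      vectorState ψ (A * B) = 0 := fun u v c h hu hv =>
    vectorState_eq_zero_of_parity h fun f => by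
      rw [act_mul, act_mul, act_fermionAlgebra_parity_mul hY hB hv,
        act_oddObservable_parity_mul hX hA hu]
  rcases hlt with hlt | hlt
  · obtain ⟨u, c, h1, h2, hu⟩ := exists_parityEigen (lam := lam) hR hx2.1 hy1.2 (by omega)
    rw [← hψ] at hu
    refine key a u c hu (fun x hx => ?_) (fun y hy hyu => ?_)
    · have := mem_Icc.1 hx
      exact ⟨by omega, by omega⟩
    · have := mem_Icc.1 hy
      have := hyu.2
      omega
  · obtain ⟨u, c, h1, h2, hu⟩ := exists_parityEigen (lam := lam) hR hy2.1 hx1.2 (by omega)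
    have hlen := hR.coverLength_eq
    rw [Int.card_Icc] at hlen
    have htot := parityEigen_amp lam R a (Λ := Icc a b) fun y h3 h4 => mem_Icc.2 ⟨h3, by omega⟩
    have hc := hu.compl htot (by omega) (by omega)
    rw [← hψ] at hc
    refine key _ _ _ hc (fun x hx => ?_) (fun y hy hyu => ?_)
    · have := mem_Icc.1 hx
      exact ⟨by omega, by omega⟩
    · have := mem_Icc.1 hy
      have := hyu.1
      omega

end Clustering

end

end VMD

theorem theorem5 (lam : ℂ) (hlam : lam ≠ 0) (a b x₁ x₂ y₁ y₂ : ℤ)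
    (hX : Finset.Icc x₁ x₂ ⊆ Finset.Icc a b) (hY : Finset.Icc y₁ y₂ ⊆ Finset.Icc a b)
    (hdist : 20 ≤ VMD.siteDist (Finset.Icc x₁ x₂) (Finset.Icc y₁ y₂))
    (R : List VMD.Domino) (hR : VMD.IsRootTiling a b R) :
    -- even fermionic observables
    (∀ A₁ ∈ VMD.evenObservables (Finset.Icc a b) (Finset.Icc x₁ x₂),
      ∀ A₂ ∈ VMD.evenObservables (Finset.Icc a b) (Finset.Icc y₁ y₂),
        ‖VMD.vectorState (VMD.fermionVMD lam a b R) (A₁ * A₂) -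
            VMD.vectorState (VMD.fermionVMD lam a b R) A₁ *
              VMD.vectorState (VMD.fermionVMD lam a b R) A₂‖ ≤
          8 * ‖A₁‖ * ‖A₂‖ *
            Real.exp (-(VMD.decayRate lam) *
              ((VMD.siteDist (Finset.Icc x₁ x₂) (Finset.Icc y₁ y₂) : ℝ) - 20) / 2)) ∧
    -- odd fermionic observables
    (∀ A₁ ∈ VMD.oddObservables (Finset.Icc a b) (Finset.Icc x₁ x₂),
      VMD.vectorState (VMD.fermionVMD lam a b R) A₁ = 0 ∧
      ∀ A₂ ∈ VMD.fermionAlgebra (Finset.Icc a b) (Finset.Icc y₁ y₂),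
        VMD.vectorState (VMD.fermionVMD lam a b R) (A₁ * A₂) = 0) ∧
    -- spin observables
    (∀ (A₁ : VMD.Op (Finset.Icc x₁ x₂)) (A₂ : VMD.Op (Finset.Icc y₁ y₂)),
        ‖VMD.vectorState (VMD.spinVMD lam a b R) (VMD.spinEmbed hX A₁ * VMD.spinEmbed hY A₂) -
            VMD.vectorState (VMD.spinVMD lam a b R) (VMD.spinEmbed hX A₁) *
              VMD.vectorState (VMD.spinVMD lam a b R) (VMD.spinEmbed hY A₂)‖ ≤
          8 * ‖A₁‖ * ‖A₂‖ *
            Real.exp (-(VMD.decayRate lam) *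
              ((VMD.siteDist (Finset.Icc x₁ x₂) (Finset.Icc y₁ y₂) : ℝ) - 20) / 2)) := by
  have hF : (VMD.fermionVMD lam a b R).ofLp = VMD.amp lam R a :=
    VMD.vmdVector_eq_amp VMD.isRaising_creation lam hR.coverLength_eq
  have hS : (VMD.spinVMD lam a b R).ofLp = VMD.amp lam R a :=
    VMD.vmdVector_eq_amp VMD.isRaising_spinRaise lam hR.coverLength_eq
  refine ⟨fun A₁ h₁ A₂ h₂ => ?_, fun A₁ h₁ => ⟨?_, fun A₂ h₂ => ?_⟩, fun A₁ A₂ => ?_⟩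
  · exact VMD.norm_covariance_le_of_siteDist hlam hR hF hX hY hdist
      (VMD.isLocal_of_mem_evenObservables hX h₁) (VMD.isLocal_of_mem_evenObservables hY h₂)
  · have := VMD.vectorState_odd_mul_eq_zero hR hF hX hY hdist h₁ (one_mem _)
    rwa [mul_one] at this
  · exact VMD.vectorState_odd_mul_eq_zero hR hF hX hY hdist h₁ h₂
  · have h₁ := VMD.isLocal_spinEmbed hX A₁
    have h₂ := VMD.isLocal_spinEmbed hY A₂
    rw [Finset.coe_Icc] at h₁ h₂
    refine (VMD.norm_covariance_le_of_siteDist hlam hR hS hX hY hdist h₁ h₂).trans ?_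
    have := VMD.norm_spinEmbed_le hX A₁
    have := VMD.norm_spinEmbed_le hY A₂
    gcongr
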